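/- All trees are leaf-labelled rooted binary trees (not planar), including the trees with a single leaf and no inner vertex; a forest on a finite set $I$ is a set of trees whose sets of leaf labels form a partition of $I$. For a forest $F$ on $I$, its support $\operatorname{Supp}(F)\subseteq I$ is the set of leaves whose path to the root contains at least one inner vertex. Let $\operatorname{Bess}(I)$ be the $\mathbb{Q}$-vector space spanned by the oriented forests $o\otimes F$, where $F$ is a forest on $I$ and $o$ is an orientation of $I$ tensor an orientation of the set of roots of $F$ (an orientation of a finite set being a generator of its top exterior power), with $(-o)\otimes F=-(o\otimes F)$. These spaces form the Bessel operad $\operatorname{Bess}=\operatorname{Det}\otimes B$. Here $\operatorname{Det}$ is the suspended commutative operad, and $B$ is the operad of root-oriented forests, generated by an antisymmetric element $e_{i,j}$ of degree $1$ (disjoint union) and a symmetric element $\omega_{i,j}$ of degree $0$ (grafting), with relations $e_{i,\star}\circ_\star e_{j,k}=e_{k,\star}\circ_\star e_{i,j}$ and $\omega_{i,\star}\circ_\star e_{j,k}=e_{j,\star}\circ_\star\omega_{i,k}-e_{k,\star}\circ_\star\omega_{i,j}$. The operad $\operatorname{Bess}$ is generated by $E_{i,j}=(j\wedge i)\otimes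 e_{i,j}$ and $\Omega_{i,j}=(i\wedge j)\otimes\omega_{i,j}$, and it is graded by the number of inner vertices. It is a Hopf operad, with the morphism of operads $\Delta:\operatorname{Bess}\to\operatorname{Bess}\otimes\operatorname{Bess}$ determined by $\Delta(E_{i,j})=E_{i,j}\otimes E_{i,j}$ and $\Delta(\Omega_{i,j})=E_{i,j}\otimes\Omega_{i,j}+\Omega_{i,j}\otimes E_{i,j}$ (with Koszul signs). So the dual space $\operatorname{Bess}^*(I)$ is an algebra for the opposite of the dual product, $\langle f\times g,x\rangle=\sum\langle f,x'\rangle\langle g,x''\rangle$ where $\Delta(x)=\sum x'\otimes x''$. It has the dual basis, still indexed by the forests on $I$, one orientation being chosen for each: the element $o\otimes F$ of $\operatorname{Bess}^*(I)$ takes the value $1$ on $o\otimes F$ and $0$ on $o'\otimes F'$ for $F'\neq F$. A forest appears in an element of $\operatorname{Bess}^*(I)$ if its coefficient in this basis is not zero. **Proposition.** Let $F_1$ and $F_2$ be two forests on $I$ with $\operatorname{Supp}(F_1)\cap\operatorname{Supp}(F_2)=\emptyset$. Then there is exactly one forest $F$ on $I$ such that $\operatorname{Supp}(F)=\operatorname{Supp}(F_1)\sqcup\operatorname{Supp}(F_2)$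 and such that $F$ coincides with $F_1$ on $\operatorname{Supp}(F_1)$ and with $F_2$ on $\operatorname{Supp}(F_2)$; that is, for $a=1,2$, the trees of $F$ with all their leaves in $\operatorname{Supp}(F_a)$ are the trees of $F_a$ with all their leaves in $\operatorname{Supp}(F_a)$. For all orientations $o_1$ of $F_1$ and $o_2$ of $F_2$, this forest $F$ appears in the product $(o_1\otimes F_1)\times(o_2\otimes F_2)$ in $\operatorname{Bess}^*(I)$, and no other forest appears in it. -/

import Mathlib

open scoped TensorProduct

namespace Bessel

section Trees

variable {ι : Type*} [DecidableEq ι]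

/-- `IsBinaryTree A N`: the family `N` is the set of vertices of a (non-planar) rooted binary tree
whose leaves are labelled bijectively by the nonempty finite set `A`.  A vertex (leaf or inner
vertex) is recorded by the set of the leaves above it; thus the leaf `i` is `{i}`, an inner vertex
is a set with at least two elements, and the vertices on the path from the leaf `i` down to the
root are the members of `N` that contain `i`. -/
inductive IsBinaryTree : Finset ι → Finset (Finset ι) → Prop
  | leaf (i : ι) : IsBinaryTree {i} {{i}}
  | graft {A B : Finset ι} {N M : Finset (Finset ι)} (h : Disjoint A B)
      (hA : IsBinaryTree A N) (hB : IsBinaryTree B M) :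
      IsBinaryTree (A ∪ B) (insert (A ∪ B) (N ∪ M))

variable (ι) in
/-- Leaf-labelled rooted binary trees, with leaf labels in `ι`. -/
@[ext]
structure LTree where
  /-- the set of leaf labels -/
  leaves : Finset ι
  /-- the leaves and the inner vertices, each given by the leaves above it -/
  vertices : Finset (Finset ι)
  isTree : IsBinaryTree leaves vertices

namespace LTree

instance : DecidableEq (LTree ι) := fun a b =>
  decidable_of_iff (a.leaves = b.leaves ∧ a.vertices = b.vertices) LTree.ext_iff.symm

noncomputable instance [Fintype ι] : Fintype (LTree ι) :=
  Fintype.ofInjective (fun T : LTree ι => (T.leaves, T.vertices)) fun a b h => by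
    simp only [Prod.mk.injEq] at h
    exact LTree.ext h.1 h.2

/-- The tree with a single leaf and no inner vertex. -/
def leaf (i : ι) : LTree ι := ⟨{i}, {{i}}, .leaf i⟩

/-- The grafting `T ∨ S` of two trees on the two leaves of the tree with one inner vertex. -/
def graft (T S : LTree ι) (h : Disjoint T.leaves S.leaves) : LTree ι :=
  ⟨T.leaves ∪ S.leaves, insert (T.leaves ∪ S.leaves) (T.vertices ∪ S.vertices),
    .graft h T.isTree S.isTree⟩

theorem leaves_nonempty (T : LTree ι) : T.leaves.Nonempty := by
  obtain ⟨A, N, h⟩ := T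
  show A.Nonempty
  induction h with
  | leaf i => exact ⟨i, by simp⟩
  | graft h hA hB ih1 ih2 => exact ih1.mono Finset.subset_union_left

end LTree

/-- A forest on the finite set `J`: a set of binary trees whose leaf sets form a partition
of `J`. -/
@[ext]
structure Forest (J : Finset ι) where
  trees : Finset (LTree ι)
  disjoint : ∀ T ∈ trees, ∀ S ∈ trees, T ≠ S → Disjoint T.leaves S.leaves
  cover : trees.biUnion LTree.leaves = J

namespace Forest

variable {J K : Finset ι}

instance : DecidableEq (Forest J) := fun a b =>
  decidable_of_iff (a.trees = b.trees) Forest.ext_iff.symm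

noncomputable instance [Fintype ι] : Fintype (Forest J) :=
  Fintype.ofInjective (fun F : Forest J => F.trees) fun _ _ h => Forest.ext h

/-- The support: the leaves `i` such that the path from `i` to the root contains at least one
inner vertex. -/
def support (F : Forest J) : Finset ι :=
  J.filter fun i => ∃ T ∈ F.trees, ∃ v ∈ T.vertices, i ∈ v ∧ 2 ≤ v.card

/-- The part of the forest `F` that lives on the set of leaves `S`: the trees of `F` all of whose
leaves belong to `S`. -/
def on (F : Forest J) (S : Finset ι) : Finset (LTree ι) :=
  F.trees.filter fun T => T.leaves ⊆ S

/-- `F` is a forest with `Supp F = Supp F₁ ∪ Supp F₂` that coincides with `F₁` on `Supp F₁` and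
with `F₂` on `Supp F₂`. -/
def IsUnionOf (F F₁ F₂ : Forest J) : Prop :=
  F.support = F₁.support ∪ F₂.support ∧
    F.on F₁.support = F₁.on F₁.support ∧ F.on F₂.support = F₂.on F₂.support

theorem leaves_subset (F : Forest J) {T : LTree ι} (hT : T ∈ F.trees) : T.leaves ⊆ J := by
  rw [← F.cover]
  exact Finset.subset_biUnion_of_mem LTree.leaves hT

/-- The disjoint union of two forests. -/
def union (h : Disjoint J K) (F : Forest J) (G : Forest K) : Forest (J ∪ K) where
  trees := F.trees ∪ G.trees
  disjoint := by
    intro T hT S hS hTS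
    rcases Finset.mem_union.1 hT with hT | hT <;> rcases Finset.mem_union.1 hS with hS | hS
    · exact F.disjoint T hT S hS hTS
    · exact Disjoint.mono (F.leaves_subset hT) (G.leaves_subset hS) h
    · exact Disjoint.mono (G.leaves_subset hT) (F.leaves_subset hS) h.symm
    · exact G.disjoint T hT S hS hTS
  cover := by rw [Finset.union_biUnion, F.cover, G.cover]

theorem leaves_disjoint (h : Disjoint J K) (F : Forest J) (G : Forest K) {T S : LTree ι}
    (hT : T ∈ F.trees) (hS : S ∈ G.trees) : Disjoint T.leaves S.leaves :=
  Disjoint.mono (F.leaves_subset hT) (G.leaves_subset hS) h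

theorem trees_disjoint (h : Disjoint J K) (F : Forest J) (G : Forest K) :
    Disjoint F.trees G.trees := by
  rw [Finset.disjoint_left]
  intro T hT hT'
  obtain ⟨i, hi⟩ := T.leaves_nonempty
  exact (Finset.disjoint_left.1 (leaves_disjoint h F G hT hT')) hi hi

/-- The disjoint union of `F` and `G`, with a tree `T` of `F` and a tree `S` of `G` replaced by
`T ∨ S`. -/
def graftAt (h : Disjoint J K) (F : Forest J) (G : Forest K) (T S : LTree ι)
    (hT : T ∈ F.trees) (hS : S ∈ G.trees) : Forest (J ∪ K) where
  trees := insert (T.graft S (leaves_disjoint h F G hT hS)) (F.trees.erase T ∪ G.trees.erase S)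
  disjoint := by
    have key : ∀ U ∈ F.trees.erase T ∪ G.trees.erase S,
        Disjoint (T.leaves ∪ S.leaves) U.leaves := by
      intro U hU
      rw [Finset.disjoint_union_left]
      rcases Finset.mem_union.1 hU with hU | hU
      · have hU' := Finset.mem_erase.1 hU
        exact ⟨F.disjoint T hT U hU'.2 hU'.1.symm, (leaves_disjoint h F G hU'.2 hS).symm⟩
      · have hU' := Finset.mem_erase.1 hU
        exact ⟨leaves_disjoint h F G hT hU'.2, G.disjoint S hS U hU'.2 hU'.1.symm⟩
    intro U hU V hV hUV
    rcases Finset.mem_insert.1 hU with hU1 | hU1 <;> rcases Finset.mem_insert.1 hV with hV1 | hV1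
    · exact absurd (hU1.trans hV1.symm) hUV
    · rw [hU1]; exact key V hV1
    · rw [hV1]; exact (key U hU1).symm
    · have sub : F.trees.erase T ∪ G.trees.erase S ⊆ (union h F G).trees :=
        Finset.union_subset_union (Finset.erase_subset _ _) (Finset.erase_subset _ _)
      exact (union h F G).disjoint U (sub hU1) V (sub hV1) hUV
  cover := by
    have e1 : T.leaves ∪ (F.trees.erase T).biUnion LTree.leaves = J := by
      rw [← Finset.biUnion_insert, Finset.insert_erase hT, F.cover]
    have e2 : S.leaves ∪ (G.trees.erase S).biUnion LTree.leaves = K := by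
      rw [← Finset.biUnion_insert, Finset.insert_erase hS, G.cover]
    rw [Finset.biUnion_insert, Finset.union_biUnion]
    conv_rhs => rw [← e1, ← e2]
    exact Finset.union_union_union_comm _ _ _ _

/-- An (outer) orientation of a forest `F` on `J`, that is, an orientation of `J` tensor an
orientation of the set of roots of `F`; equivalently, an orientation of the disjoint union of `J`
and of the set of roots.  It is given by listing the elements of this disjoint union, each exactly
once, and the list stands for the exterior product of its entries; a root is identified with
its tree. -/
structure Orientation (F : Forest J) where
  list : List (ι ⊕ LTree ι)
  nodup : list.Nodup
  mem_iff : ∀ g, g ∈ list ↔ g ∈ J.disjSum F.trees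

end Forest

end Trees

section Ext

variable (ι : Type*) [DecidableEq ι]

/-- The exterior algebra over `ℚ` on the disjoint union of the set of labels and of the set of
trees (that is, of their roots). -/
abbrev Ext := ExteriorAlgebra ℚ ((ι ⊕ LTree ι) →₀ ℚ)

variable {ι}

/-- A label or a root as an element of the exterior algebra. -/
noncomputable def gen (g : ι ⊕ LTree ι) : Ext ι := ExteriorAlgebra.ι ℚ (Finsupp.single g 1)

/-- The exterior product of the entries of a list. -/
noncomputable def word (L : List (ι ⊕ LTree ι)) : Ext ι := (L.map gen).prod

/-- The grading involution: `1` in even degree and `-1` in odd degree. -/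
noncomputable def inv : Ext ι →ₗ[ℚ] Ext ι := (CliffordAlgebra.involute).toLinearMap

/-- The interior product (left contraction, "partial derivative") with respect to `g`:
`g ∧ g₂ ∧ ⋯ ∧ gₙ` is sent to `g₂ ∧ ⋯ ∧ gₙ`. -/
noncomputable def del (g : ι ⊕ LTree ι) : Ext ι →ₗ[ℚ] Ext ι :=
  CliffordAlgebra.contractLeft (Finsupp.lapply g)

/-- The coefficient of `g₁ ∧ ⋯ ∧ gₙ` (for `gᵢ` distinct) in an element of the exterior algebra. -/
noncomputable def coeff : List (ι ⊕ LTree ι) → Ext ι →ₗ[ℚ] ℚ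
  | [] => (ExteriorAlgebra.algebraMapInv).toLinearMap
  | g :: L => coeff L ∘ₗ del g

/-- The bilinear operation `x, y ↦ ∑ (T ∨ S) ∧ ∂_T (inv x) ∧ ∂_S y`, the sum being over the pairs
of trees with disjoint sets of leaves. -/
noncomputable def bracket [Fintype ι] : Ext ι →ₗ[ℚ] Ext ι →ₗ[ℚ] Ext ι :=
  ∑ T : LTree ι, ∑ S : LTree ι,
    if h : Disjoint T.leaves S.leaves then
      (LinearMap.mul ℚ (Ext ι)).compl₁₂
        (LinearMap.mulLeft ℚ (gen (Sum.inr (T.graft S h))) ∘ₗ del (Sum.inr T) ∘ₗ inv)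
        (del (Sum.inr S))
    else 0

theorem gen_mul_gen (a b : ι ⊕ LTree ι) : gen a * gen b = -(gen b * gen a) := by
  rw [eq_neg_iff_add_eq_zero]
  exact ExteriorAlgebra.ι_add_mul_swap _ _

theorem word_cons (g : ι ⊕ LTree ι) (L) : word (g :: L) = gen g * word L := by
  simp [word]

theorem word_append (L L' : List (ι ⊕ LTree ι)) : word (L ++ L') = word L * word L' := by
  simp [word]

theorem word_perm {L L' : List (ι ⊕ LTree ι)} (h : L.Perm L') :
    word L = word L' ∨ word L = -word L' := by
  induction h with
  | nil => exact Or.inl rfl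
  | cons x _ ih =>
    rw [word_cons, word_cons]
    rcases ih with ih | ih <;> simp [ih]
  | swap x y l =>
    right
    rw [word_cons, word_cons, word_cons, word_cons, ← mul_assoc, gen_mul_gen, neg_mul, mul_assoc]
  | trans _ _ ih1 ih2 =>
    rcases ih1 with ih1 | ih1 <;> rcases ih2 with ih2 | ih2 <;> simp [ih1, ih2]

theorem inv_word (L : List (ι ⊕ LTree ι)) : inv (word L) = word L ∨ inv (word L) = -word L := by
  induction L with
  | nil => left; simp [word, inv]
  | cons g L ih =>
    have e : inv (word (g :: L)) = -gen g * inv (word L) := by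
      rw [word_cons]
      simp [inv, gen]
    rcases ih with ih | ih <;> rw [e, ih, word_cons] <;> simp

theorem del_gen_mul (g a : ι ⊕ LTree ι) (x : Ext ι) :
    del g (gen a * x) = (if a = g then x else 0) - gen a * del g x := by
  have := CliffordAlgebra.contractLeft_ι_mul (Q := (0 : QuadraticForm ℚ ((ι ⊕ LTree ι) →₀ ℚ)))
    (Finsupp.lapply g) (Finsupp.single a (1 : ℚ)) x
  refine this.trans ?_
  congr 1
  simp only [Finsupp.lapply_apply, Finsupp.single_apply]
  split_ifs <;> simp

theorem del_word_of_notMem {g : ι ⊕ LTree ι} {L : List (ι ⊕ LTree ι)} (h : g ∉ L) :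
    del g (word L) = 0 := by
  induction L with
  | nil => simp [word, del]
  | cons a L ih =>
    simp only [List.mem_cons, not_or] at h
    rw [word_cons, del_gen_mul, if_neg (Ne.symm h.1), ih h.2]
    simp

theorem del_word_of_perm {g : ι ⊕ LTree ι} {L L' : List (ι ⊕ LTree ι)} (hL : L.Nodup)
    (h : L.Perm (g :: L')) : del g (word L) = word L' ∨ del g (word L) = -word L' := by
  have hg : g ∉ L' := (List.nodup_cons.1 (h.nodup_iff.1 hL)).1
  have e : del g (word (g :: L')) = word L' := by
    rw [word_cons, del_gen_mul, if_pos rfl, del_word_of_notMem hg]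
    simp
  rcases word_perm h with h' | h' <;> rw [h'] <;> simp [e]

end Ext

section Bess

variable {ι : Type*} [DecidableEq ι] {J K : Finset ι}

/-- The space `Bess(J)`, spanned by the oriented forests `o ⊗ F` on `J`, i.e. by the exterior
products `o = g₁ ∧ ⋯ ∧ gₙ` where `g₁, …, gₙ` is a list of the elements of `J` and of the roots of
a forest `F` on `J`. -/
noncomputable def Bess (J : Finset ι) : Submodule ℚ (Ext ι) :=
  Submodule.span ℚ {x | ∃ (F : Forest J) (o : F.Orientation), word o.list = x}

/-- The oriented forest `o ⊗ F` as an element of `Bess(J)`. -/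
noncomputable def Forest.Orientation.elt {F : Forest J} (o : F.Orientation) : Bess J :=
  ⟨word o.list, Submodule.subset_span ⟨F, o, rfl⟩⟩

theorem word_mem {F : Forest J} {L : List (ι ⊕ LTree ι)} (h : L.Nodup)
    (h' : ∀ g, g ∈ L ↔ g ∈ J.disjSum F.trees) : word L ∈ Bess J :=
  Submodule.subset_span ⟨F, ⟨L, h, h'⟩, rfl⟩

theorem inv_mem {x : Ext ι} (hx : x ∈ Bess J) : inv x ∈ Bess J := by
  have : (Bess J).map inv ≤ Bess J := by
    rw [Bess, Submodule.map_span, Submodule.span_le]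
    rintro _ ⟨_, ⟨F, o, rfl⟩, rfl⟩
    rcases inv_word o.list with h | h <;> rw [h]
    · exact word_mem o.nodup o.mem_iff
    · exact neg_mem (word_mem o.nodup o.mem_iff)
  exact this (Submodule.mem_map_of_mem hx)

theorem mul_mem_Bess (h : Disjoint J K) {x y : Ext ι} (hx : x ∈ Bess J) (hy : y ∈ Bess K) :
    LinearMap.mul ℚ (Ext ι) x y ∈ Bess (J ∪ K) := by
  have : Submodule.map₂ (LinearMap.mul ℚ (Ext ι)) (Bess J) (Bess K) ≤ Bess (J ∪ K) := by
    rw [Bess, Bess, Submodule.map₂_span_span, Submodule.span_le]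
    rintro _ ⟨_, ⟨F, o, rfl⟩, _, ⟨G, p, rfl⟩, rfl⟩
    simp only [LinearMap.mul_apply', SetLike.mem_coe]
    rw [← word_append]
    refine word_mem (F := F.union h G) (List.Nodup.append o.nodup p.nodup ?_) ?_
    · intro g hg hg'
      rw [o.mem_iff] at hg
      rw [p.mem_iff] at hg'
      rcases g with i | T
      · simp only [Finset.inl_mem_disjSum] at hg hg'
        exact Finset.disjoint_left.1 h hg hg'
      · simp only [Finset.inr_mem_disjSum] at hg hg'
        exact Finset.disjoint_left.1 (Forest.trees_disjoint h F G) hg hg'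
    · intro g
      rw [List.mem_append, o.mem_iff, p.mem_iff]
      rcases g with i | T <;> simp [Forest.union]
  exact this (Submodule.apply_mem_map₂ _ hx hy)

theorem bracket_mem [Fintype ι] (h : Disjoint J K) {x y : Ext ι} (hx : x ∈ Bess J)
    (hy : y ∈ Bess K) : bracket x y ∈ Bess (J ∪ K) := by
  have : Submodule.map₂ (bracket (ι := ι)) (Bess J) (Bess K) ≤ Bess (J ∪ K) := by
    rw [Bess, Bess, Submodule.map₂_span_span, Submodule.span_le]
    rintro _ ⟨_, ⟨F, o, rfl⟩, _, ⟨G, p, rfl⟩, rfl⟩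
    simp only [bracket, LinearMap.sum_apply, SetLike.mem_coe]
    refine Submodule.sum_mem _ fun T _ => Submodule.sum_mem _ fun S _ => ?_
    split_ifs with hTS
    swap
    · simp
    simp only [LinearMap.compl₁₂_apply, LinearMap.mul_apply', LinearMap.comp_apply,
      LinearMap.mulLeft_apply]
    have pm : ∀ {a b : Ext ι}, a = b ∨ a = -b → b ∈ Bess (J ∪ K) → a ∈ Bess (J ∪ K) := by
      rintro a b (rfl | rfl) hb
      · exact hb
      · exact neg_mem hb
    by_cases hT : T ∈ F.trees
    swap
    · have hT' : (Sum.inr T : ι ⊕ LTree ι) ∉ o.list := by simpa [o.mem_iff] using hT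
      rcases inv_word o.list with e | e <;> rw [e] <;> simp [del_word_of_notMem hT']
    by_cases hS : S ∈ G.trees
    swap
    · have hS' : (Sum.inr S : ι ⊕ LTree ι) ∉ p.list := by simpa [p.mem_iff] using hS
      simp [del_word_of_notMem hS']
    have hT' : (Sum.inr T : ι ⊕ LTree ι) ∈ o.list := by simpa [o.mem_iff] using hT
    have hS' : (Sum.inr S : ι ⊕ LTree ι) ∈ p.list := by simpa [p.mem_iff] using hS
    obtain ⟨a, b, hab⟩ := List.append_of_mem hT'
    obtain ⟨c, d, hcd⟩ := List.append_of_mem hS'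
    have h1 : o.list.Perm (Sum.inr T :: (a ++ b)) := by rw [hab]; exact List.perm_middle
    have h2 : p.list.Perm (Sum.inr S :: (c ++ d)) := by rw [hcd]; exact List.perm_middle
    have n1 := List.nodup_cons.1 (h1.nodup_iff.1 o.nodup)
    have n2 := List.nodup_cons.1 (h2.nodup_iff.1 p.nodup)
    have m1 : ∀ g, g ∈ a ++ b ↔ g ∈ J.disjSum (F.trees.erase T) := by
      intro g
      have := (h1.mem_iff (a := g)).symm.trans (o.mem_iff g)
      rw [List.mem_cons] at this
      rcases g with i | U
      · simpa using this
      · by_cases e : U = T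
        · subst e; simpa using n1.1
        · simpa [e] using this
    have m2 : ∀ g, g ∈ c ++ d ↔ g ∈ K.disjSum (G.trees.erase S) := by
      intro g
      have := (h2.mem_iff (a := g)).symm.trans (p.mem_iff g)
      rw [List.mem_cons] at this
      rcases g with i | U
      · simpa using this
      · by_cases e : U = S
        · subst e; simpa using n2.1
        · simpa [e] using this
    have key : word (Sum.inr (T.graft S hTS) :: ((a ++ b) ++ (c ++ d))) ∈ Bess (J ∪ K) := by
      refine word_mem (F := F.graftAt h G T S hT hS) ?_ ?_
      · refine List.nodup_cons.2 ⟨?_, List.Nodup.append n1.2 n2.2 ?_⟩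
        · rw [List.mem_append, m1, m2]
          obtain ⟨i, hi⟩ := T.leaves_nonempty
          obtain ⟨j, hj⟩ := S.leaves_nonempty
          simp only [Finset.inr_mem_disjSum, Finset.mem_erase, not_or, not_and]
          constructor
          · intro _ hm
            exact Finset.disjoint_left.1 h (F.leaves_subset hm (Finset.mem_union_right _ hj))
              (G.leaves_subset hS hj)
          · intro _ hm
            exact Finset.disjoint_left.1 h (F.leaves_subset hT hi)
              (G.leaves_subset hm (Finset.mem_union_left _ hi))
        · intro g hg hg'
          rw [m1] at hg
          rw [m2] at hg'
          rcases g with i | U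
          · simp only [Finset.inl_mem_disjSum] at hg hg'
            exact Finset.disjoint_left.1 h hg hg'
          · simp only [Finset.inr_mem_disjSum, Finset.mem_erase] at hg hg'
            exact Finset.disjoint_left.1 (Forest.trees_disjoint h F G) hg.2 hg'.2
      · intro g
        rw [List.mem_cons, List.mem_append, m1, m2]
        rcases g with i | U <;> simp [Forest.graftAt]
    refine pm ?_ key
    rw [word_cons, word_append]
    rcases inv_word o.list with e | e <;> rcases del_word_of_perm o.nodup h1 with e1 | e1 <;>
      rcases del_word_of_perm p.nodup h2 with e2 | e2 <;> simp [e, e1, e2, mul_assoc]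
  exact this (Submodule.apply_mem_map₂ _ hx hy)

/-- The Koszul parity operator on `Bess(J)`: `x ↦ (-1)^|x| x`.  An oriented forest on `J` is an
exterior product of `|J|` labels and of the roots, so the parity of its exterior degree is that of
`|J|` minus the number of roots, which is the number of inner vertices. -/
noncomputable def parity (J : Finset ι) : Bess J →ₗ[ℚ] Bess J :=
  inv.restrict fun _ hx => inv_mem hx

/-- The restriction of a bilinear operation of the exterior algebra. -/
noncomputable def restrict₂ {J K L : Finset ι} (f : Ext ι →ₗ[ℚ] Ext ι →ₗ[ℚ] Ext ι)
    (hf : ∀ x ∈ Bess J, ∀ y ∈ Bess K, f x y ∈ Bess L) : Bess J ⊗[ℚ] Bess K →ₗ[ℚ] Bess L :=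
  TensorProduct.lift <| LinearMap.mk₂ ℚ (fun x y => ⟨f x y, hf x x.2 y y.2⟩)
    (fun _ _ _ => Subtype.ext (by simp)) (fun _ _ _ => Subtype.ext (by simp))
    (fun _ _ _ => Subtype.ext (by simp)) (fun _ _ _ => Subtype.ext (by simp))

/-- The action of the generator `E` of the operad, `x ⊗ y ↦ E_{⋆,#} ∘_⋆ x ∘_# y`.  On oriented
forests it is `(o₁ ⊗ F₁) ⊗ (o₂ ⊗ F₂) ↦ (o₁ ∧ o₂) ⊗ (F₁ ⊔ F₂)`. -/
noncomputable def opE (h : Disjoint J K) : Bess J ⊗[ℚ] Bess K →ₗ[ℚ] Bess (J ∪ K) :=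
  restrict₂ (LinearMap.mul ℚ (Ext ι)) fun _ hx _ hy => mul_mem_Bess h hx hy

/-- The action of the generator `Ω` of the operad, `x ⊗ y ↦ Ω_{⋆,#} ∘_⋆ x ∘_# y`.  On oriented
forests it is `(o₁ ⊗ F₁) ⊗ (o₂ ⊗ F₂) ↦ ± ∑ F`, the sum being over all the ways to replace, in
`F₁ ⊔ F₂`, a tree `T` of `F₁` and a tree `S` of `F₂` by `T ∨ S`. In particular the sign is such that
`(a ∧ T) ⊗ (b ∧ S) ↦ (-1)^(|A| - 1) a ∧ b ∧ (T ∨ S)` where `a`, `b` are orientations of the sets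
of leaves `A`, `B` of the trees `T`, `S`; it is antisymmetric and is a derivation of degree one
with respect to `E`. -/
noncomputable def opΩ [Fintype ι] (h : Disjoint J K) : Bess J ⊗[ℚ] Bess K →ₗ[ℚ] Bess (J ∪ K) :=
  restrict₂ bracket fun _ hx _ hy => bracket_mem h hx hy

/-- The Koszul symmetry `x ⊗ y ↦ (-1)^(|x| |y|) y ⊗ x`, which on homogeneous elements is
`y ⊗ x` if `x` or `y` is even and `- y ⊗ x` if both are odd. -/
noncomputable def braid (J K : Finset ι) : Bess J ⊗[ℚ] Bess K →ₗ[ℚ] Bess K ⊗[ℚ] Bess J :=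
  ((1 / 2 : ℚ) • (LinearMap.id + TensorProduct.map (parity K) LinearMap.id
    + TensorProduct.map LinearMap.id (parity J) + TensorProduct.map (parity K) (-parity J)))
    ∘ₗ (TensorProduct.comm ℚ (Bess J) (Bess K)).toLinearMap

/-- The map `(x' ⊗ x'') ⊗ (y' ⊗ y'') ↦ (-1)^(|x''| |y'|) P (x' ⊗ y') ⊗ Q (x'' ⊗ y'')`. -/
noncomputable def tensorOp (P Q : Bess J ⊗[ℚ] Bess K →ₗ[ℚ] Bess (J ∪ K)) :
    (Bess J ⊗[ℚ] Bess J) ⊗[ℚ] (Bess K ⊗[ℚ] Bess K) →ₗ[ℚ] Bess (J ∪ K) ⊗[ℚ] Bess (J ∪ K) :=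
  TensorProduct.map P Q
    ∘ₗ (TensorProduct.tensorTensorTensorAssoc ℚ (Bess J) (Bess K) (Bess J) (Bess K)).symm
    ∘ₗ TensorProduct.map (TensorProduct.map LinearMap.id (braid J K)) LinearMap.id
    ∘ₗ (TensorProduct.tensorTensorTensorAssoc ℚ (Bess J) (Bess J) (Bess K) (Bess K)).toLinearMap

/-- The action of `Δ(E) = E ⊗ E` in the operad `Bess ⊗ Bess`. -/
noncomputable def deltaE (h : Disjoint J K) :
    (Bess J ⊗[ℚ] Bess J) ⊗[ℚ] (Bess K ⊗[ℚ] Bess K) →ₗ[ℚ] Bess (J ∪ K) ⊗[ℚ] Bess (J ∪ K) :=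
  tensorOp (opE h) (opE h)

/-- The action of `Δ(Ω) = E ⊗ Ω + Ω ⊗ E` in the operad `Bess ⊗ Bess`; in the first summand, `Ω`,
which is of degree one, moves past `x'` and `y'`. -/
noncomputable def deltaΩ [Fintype ι] (h : Disjoint J K) :
    (Bess J ⊗[ℚ] Bess J) ⊗[ℚ] (Bess K ⊗[ℚ] Bess K) →ₗ[ℚ] Bess (J ∪ K) ⊗[ℚ] Bess (J ∪ K) :=
  tensorOp (opE h ∘ₗ TensorProduct.map (parity J) (parity K)) (opΩ h)
    + tensorOp (opΩ h) (opE h)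

/-- The monomials in the generator `Ω` alone (planar binary trees). -/
inductive TreeMonomial : Finset ι → Type _
  | leaf (i : ι) : TreeMonomial {i}
  | node {J K : Finset ι} (h : Disjoint J K) (s : TreeMonomial J) (t : TreeMonomial K) :
      TreeMonomial (J ∪ K)

/-- The iterated products under the generator `E` of monomials in `Ω` (the empty product is
allowed for the empty set of labels). -/
inductive ForestMonomial : Finset ι → Type _
  | nil : ForestMonomial ∅
  | cons {J K : Finset ι} (h : Disjoint J K) (s : TreeMonomial J) (t : ForestMonomial K) :
      ForestMonomial (J ∪ K)

/-- The forest with the single tree `T`. -/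
def LTree.toForest (T : LTree ι) : Forest T.leaves :=
  ⟨{T}, by simp, by simp⟩

/-- The unit of the operad: the tree with one leaf `i` and no inner vertex, with outer
orientation `i ⊗ root`. -/
noncomputable def unitElt (i : ι) : Bess ({i} : Finset ι) :=
  Forest.Orientation.elt (F := (LTree.leaf i).toForest)
    ⟨[Sum.inl i, Sum.inr (LTree.leaf i)], by simp, by
      rintro (j | T) <;> simp [LTree.toForest, LTree.leaf]⟩

/-- The empty forest. -/
noncomputable def emptyElt : Bess (∅ : Finset ι) :=
  Forest.Orientation.elt (F := ⟨∅, by simp, by simp⟩) ⟨[], by simp, by simp⟩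

/-- The value in the operad `Bess` of a monomial in `Ω`. -/
noncomputable def TreeMonomial.eval [Fintype ι] : {J : Finset ι} → TreeMonomial J → Bess J
  | _, .leaf i => unitElt i
  | _, .node h s t => opΩ h (s.eval ⊗ₜ t.eval)

/-- The value of a monomial in the operad `Bess`. -/
noncomputable def ForestMonomial.eval [Fintype ι] : {J : Finset ι} → ForestMonomial J → Bess J
  | _, .nil => emptyElt
  | _, .cons h s t => opE h (s.eval ⊗ₜ t.eval)

/-- The value in the operad `Bess ⊗ Bess` of a monomial, `Ω` being replaced by `Δ(Ω)`. -/
noncomputable def TreeMonomial.delta [Fintype ι] :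
    {J : Finset ι} → TreeMonomial J → Bess J ⊗[ℚ] Bess J
  | _, .leaf i => unitElt i ⊗ₜ unitElt i
  | _, .node h s t => deltaΩ h (s.delta ⊗ₜ t.delta)

/-- The value in the operad `Bess ⊗ Bess` of a monomial, `E` and `Ω` being replaced by `Δ(E)` and
`Δ(Ω)`. -/
noncomputable def ForestMonomial.delta [Fintype ι] :
    {J : Finset ι} → ForestMonomial J → Bess J ⊗[ℚ] Bess J
  | _, .nil => emptyElt ⊗ₜ emptyElt
  | _, .cons h s t => deltaE h (s.delta ⊗ₜ t.delta)

theorem coe_unitElt (i : ι) :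
    (unitElt i : Ext ι) = word [Sum.inl i, Sum.inr (LTree.leaf i)] := rfl

theorem bracket_word [Fintype ι] (T S : LTree ι) (h : Disjoint T.leaves S.leaves) (L M : List ι) :
    bracket (word (Sum.inr T :: L.map Sum.inl)) (word (Sum.inr S :: M.map Sum.inl)) =
        word (Sum.inr (T.graft S h) :: (L ++ M).map Sum.inl) ∨
      bracket (word (Sum.inr T :: L.map Sum.inl)) (word (Sum.inr S :: M.map Sum.inl)) =
        -word (Sum.inr (T.graft S h) :: (L ++ M).map Sum.inl) := by
  have d : ∀ (U V : LTree ι) (L : List ι), del (Sum.inr U) (word (Sum.inr V :: L.map Sum.inl)) =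
      if V = U then word (L.map Sum.inl) else 0 := by
    intro U V L
    rw [word_cons, del_gen_mul, del_word_of_notMem (by simp)]
    simp
  have e : bracket (word (Sum.inr T :: L.map Sum.inl)) (word (Sum.inr S :: M.map Sum.inl)) =
      gen (Sum.inr (T.graft S h)) * del (Sum.inr T) (inv (word (Sum.inr T :: L.map Sum.inl))) *
        word (M.map Sum.inl) := by
    simp only [bracket, LinearMap.sum_apply]
    rw [Finset.sum_eq_single T, Finset.sum_eq_single S]
    · rw [dif_pos h]
      simp [d]
    · intro U _ hU
      split_ifs
      · simp [d, Ne.symm hU]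
      · simp
    · simp
    · intro U _ hU
      refine Finset.sum_eq_zero fun V _ => ?_
      split_ifs
      · rcases inv_word (Sum.inr T :: L.map Sum.inl) with e | e <;> simp [d, Ne.symm hU, e]
      · simp
    · simp
  rw [e, List.map_append, word_cons (Sum.inr (T.graft S h)), word_append]
  rcases inv_word (Sum.inr T :: L.map Sum.inl) with e' | e' <;> simp [d, e', mul_assoc]

theorem exists_treeMonomial_aux [Fintype ι] {A : Finset ι} {N : Finset (Finset ι)}
    (h : IsBinaryTree A N) : ∃ (t : TreeMonomial A) (L : List ι), L.Nodup ∧ (∀ i, i ∈ L ↔ i ∈ A) ∧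
      ((t.eval : Ext ι) = word (Sum.inr ⟨A, N, h⟩ :: L.map Sum.inl) ∨
        (t.eval : Ext ι) = -word (Sum.inr ⟨A, N, h⟩ :: L.map Sum.inl)) := by
  induction h with
  | leaf i =>
    refine ⟨.leaf i, [i], by simp, by simp, ?_⟩
    rw [TreeMonomial.eval, coe_unitElt]
    exact word_perm (List.Perm.swap _ _ _)
  | @graft A B N M h hA hB ih1 ih2 =>
    obtain ⟨s, L, hL, hL', hs⟩ := ih1
    obtain ⟨t, L2, hM, hM', ht⟩ := ih2
    refine ⟨.node h s t, L ++ L2, hL.append hM ?_, ?_, ?_⟩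
    · intro i hi hi'
      exact Finset.disjoint_left.1 h ((hL' i).1 hi) ((hM' i).1 hi')
    · intro i
      rw [List.mem_append, hL', hM', Finset.mem_union]
    · have e : ((TreeMonomial.node h s t).eval : Ext ι) = bracket (s.eval : Ext ι) t.eval := rfl
      rw [e]
      have := bracket_word ⟨A, N, hA⟩ ⟨B, M, hB⟩ h L L2
      simp only [LTree.graft] at this
      rcases hs with hs | hs <;> rcases ht with ht | ht <;> rcases this with h' | h' <;>
        simp [hs, ht, h']

theorem exists_treeMonomial [Fintype ι] (T : LTree ι) :
    ∃ (t : TreeMonomial T.leaves) (L : List (ι ⊕ LTree ι)), L.Nodup ∧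
      (∀ g, g ∈ L ↔ g ∈ T.leaves.disjSum {T}) ∧ (t.eval : Ext ι) = word L := by
  obtain ⟨t, L, hL, hL', ht⟩ := exists_treeMonomial_aux T.isTree
  have nd : (Sum.inr T :: L.map Sum.inl : List (ι ⊕ LTree ι)).Nodup :=
    List.nodup_cons.2 ⟨by simp, hL.map Sum.inl_injective⟩
  have hm : ∀ g, g ∈ (Sum.inr T :: L.map Sum.inl : List (ι ⊕ LTree ι)) ↔
      g ∈ T.leaves.disjSum {T} := by
    rintro (i | U) <;> simp [hL']
  rcases ht with ht | ht
  · exact ⟨t, _, nd, hm, ht⟩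
  · obtain ⟨i, hi⟩ := T.leaves_nonempty
    rcases L with _ | ⟨j, L⟩
    · exact absurd ((hL' i).2 hi) (by simp)
    · have p : (Sum.inl j :: Sum.inr T :: L.map Sum.inl : List (ι ⊕ LTree ι)).Perm
          (Sum.inr T :: (j :: L).map Sum.inl) := List.Perm.swap _ _ _
      refine ⟨t, _, p.nodup_iff.2 nd, fun g => p.mem_iff.trans (hm g), ?_⟩
      rw [ht, List.map_cons, word_cons, word_cons, word_cons, word_cons, ← mul_assoc,
        gen_mul_gen, neg_mul, neg_neg, mul_assoc]

theorem exists_forestMonomial_aux [Fintype ι] (s : Finset (LTree ι)) :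
    (∀ T ∈ s, ∀ S ∈ s, T ≠ S → Disjoint T.leaves S.leaves) →
    ∃ (t : ForestMonomial (s.biUnion LTree.leaves)) (L : List (ι ⊕ LTree ι)), L.Nodup ∧
      (∀ g, g ∈ L ↔ g ∈ (s.biUnion LTree.leaves).disjSum s) ∧ (t.eval : Ext ι) = word L := by
  induction s using Finset.induction_on with
  | empty => exact fun _ => ⟨.nil, [], by simp, by simp, rfl⟩
  | insert T s hT ih =>
    intro h
    obtain ⟨t, L, hL, hL', ht⟩ := ih fun U hU V hV =>
      h U (Finset.mem_insert_of_mem hU) V (Finset.mem_insert_of_mem hV)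
    obtain ⟨u, M, hM, hM', hu⟩ := exists_treeMonomial T
    have hd : Disjoint T.leaves (s.biUnion LTree.leaves) := by
      rw [Finset.disjoint_biUnion_right]
      intro U hU
      exact h T (Finset.mem_insert_self _ _) U (Finset.mem_insert_of_mem hU)
        (fun e => hT (e ▸ hU))
    rw [Finset.biUnion_insert]
    refine ⟨.cons hd u t, M ++ L, hM.append hL ?_, ?_, ?_⟩
    · intro g hg hg'
      rw [hM'] at hg
      rw [hL'] at hg'
      rcases g with i | U
      · rw [Finset.inl_mem_disjSum] at hg hg'
        exact Finset.disjoint_left.1 hd hg hg'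
      · rw [Finset.inr_mem_disjSum] at hg hg'
        exact hT (Finset.mem_singleton.1 hg ▸ hg')
    · intro g
      rw [List.mem_append, hM', hL']
      rcases g with i | U
      · simp only [Finset.inl_mem_disjSum, Finset.mem_union]
      · simp only [Finset.inr_mem_disjSum, Finset.mem_singleton, Finset.mem_insert]
    · rw [word_append, ← hu, ← ht]
      rfl

/-- Every forest is, with a suitable orientation, the value of a monomial. -/
theorem exists_forestMonomial [Fintype ι] (F : Forest J) :
    ∃ p : ForestMonomial J × F.Orientation, p.1.eval = p.2.elt := by
  obtain ⟨s, hs, rfl⟩ := F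
  obtain ⟨t, L, hL, hL', ht⟩ := exists_forestMonomial_aux s hs
  exact ⟨⟨t, ⟨L, hL, hL'⟩⟩, Subtype.ext ht⟩

/-- A monomial whose value is the forest `F` with some orientation. -/
noncomputable def Forest.monomial [Fintype ι] (F : Forest J) : ForestMonomial J :=
  (exists_forestMonomial F).choose.1

/-- The orientation `o` of `F` such that the value of the monomial `F.monomial` is `o ⊗ F`. -/
noncomputable def Forest.orientation [Fintype ι] (F : Forest J) : F.Orientation :=
  (exists_forestMonomial F).choose.2

theorem Forest.eval_monomial [Fintype ι] (F : Forest J) :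
    F.monomial.eval = F.orientation.elt :=
  (exists_forestMonomial F).choose_spec

/-- The element of the dual space `Bess*(J)` that is indexed by the oriented forest `o ⊗ F`: its
value is `1` on `o ⊗ F`, hence `-1` on `F` with the opposite orientation, and `0` on `o' ⊗ F'`
if `F' ≠ F`. -/
noncomputable def Forest.Orientation.dual {F : Forest J} (o : F.Orientation) :
    Module.Dual ℚ (Bess J) :=
  coeff o.list ∘ₗ (Bess J).subtype

theorem Forest.Orientation.dual_elt_self {F : Forest J} (o : F.Orientation) :
    o.dual o.elt = 1 := by
  have key : ∀ L : List (ι ⊕ LTree ι), L.Nodup → coeff L (word L) = 1 := by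
    intro L
    induction L with
    | nil => intro _; simp [coeff, word]
    | cons g L ih =>
      intro h
      rw [List.nodup_cons] at h
      rw [coeff, LinearMap.comp_apply, word_cons, del_gen_mul, if_pos rfl,
        del_word_of_notMem h.1, mul_zero, sub_zero, ih h.2]
  exact key _ o.nodup

theorem Forest.Orientation.dual_elt_of_ne {F F' : Forest J} (o : F.Orientation)
    (o' : F'.Orientation) (h : F ≠ F') : o.dual o'.elt = 0 := by
  have key : ∀ L L' : List (ι ⊕ LTree ι), L'.Nodup → ¬ L.Perm L' → coeff L (word L') = 0 := by
    intro L
    induction L with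
    | nil =>
      intro L' _ hp
      rcases L' with _ | ⟨g, L'⟩
      · exact absurd (List.Perm.refl _) hp
      · simp [coeff, word_cons, gen, ExteriorAlgebra.algebraMapInv]
    | cons g L ih =>
      intro L' hn hp
      rw [coeff, LinearMap.comp_apply]
      by_cases hg : g ∈ L'
      · obtain ⟨a, b, rfl⟩ := List.append_of_mem hg
        have p : (a ++ g :: b).Perm (g :: (a ++ b)) := List.perm_middle
        have z := ih (a ++ b) (List.nodup_cons.1 (p.nodup_iff.1 hn)).2
          fun q => hp ((q.cons g).trans p.symm)
        rcases del_word_of_perm hn p with e | e <;> rw [e] <;> simp [z]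
      · rw [del_word_of_notMem hg, map_zero]
  refine key _ _ o'.nodup fun p => h ?_
  ext T
  have := ((o.mem_iff (Sum.inr T)).symm.trans p.mem_iff).trans (o'.mem_iff (Sum.inr T))
  simpa using this

/-- The coproduct `Δ : Bess(J) → Bess(J) ⊗ Bess(J)`, which is the morphism of operads from `Bess`
to `Bess ⊗ Bess` with `Δ(E) = E ⊗ E` and `Δ(Ω) = E ⊗ Ω + Ω ⊗ E`: for each forest `F` on `J` (with
one of its orientations, which form a basis of `Bess(J)`), written as a monomial in `E` and `Ω`,
its value is the same monomial in `Δ(E)` and `Δ(Ω)`. -/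
noncomputable def coproduct [Fintype ι] (J : Finset ι) :
    Bess J →ₗ[ℚ] Bess J ⊗[ℚ] Bess J :=
  ∑ F : Forest J, F.orientation.dual.smulRight F.monomial.delta

/-- The product `f × g` of the algebra `Bess*(J)`, i.e. the opposite of the dual product of the
coproduct: `(f × g)(x) = ∑ f(x') g(x'')` for `Δ(x) = ∑ x' ⊗ x''`, without a Koszul sign. -/
noncomputable def dualMul [Fintype ι] (f g : Module.Dual ℚ (Bess J)) : Module.Dual ℚ (Bess J) :=
  TensorProduct.dualDistrib ℚ (Bess J) (Bess J) (f ⊗ₜ g) ∘ₗ coproduct J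

/-- The forest `F` appears in the element `f` of `Bess*(J)`: the coefficient of `F`, with one of
its orientations, in the expansion of `f` in the dual basis is not zero. -/
def Forest.Appears (F : Forest J) (f : Module.Dual ℚ (Bess J)) : Prop :=
  ∃ o : F.Orientation, f o.elt ≠ 0

end Bess

end Bessel

namespace Bessel

/-! ### Forests and their trees with inner vertices -/

section Trees

variable {ι : Type*} [DecidableEq ι]

/-! The coefficient of `F` in the product is, up to sign, the coefficient of `F₁ ⊗ F₂` in `Δ(F)`, so
the only question is when the latter vanishes. No sign has to be computed: every comparison is made
up to a nonzero scalar.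

Since `Δ(E) = E ⊗ E`, the coefficient for a disjoint union is, up to sign, the product of the
coefficients of the two parts (`coeffPair_deltaE_union`), and it vanishes when `F₁` or `F₂` does not
split along the same partition of the labels (`coeffPair_deltaE_of_ne`). This reduces everything to
a monomial in `Ω` alone, whose value is a single tree on `J` up to sign.

For a tree there are two cases (`TreeMonomial.coeffPair_delta_ne_zero_iff`). The coproduct preserves
the number of inner vertices, which is `|J| - 1` for a tree, while a forest with `b` trees that are
not single leaves has `|Supp| - b` inner vertices. If `F₁` and `F₂` both have inner vertices and
their supports are disjoint, they have at most `|J| - 2` inner vertices together, so the coefficient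
is zero; and a single tree is not the union of two such forests either. If one of them, say `F₂`,
has no inner vertex, pairing the second factor of `Δ` with it acts as a counit up to a nonzero
scalar (`TreeMonomial.evalRight_delta`): the term `E ⊗ Ω` dies, because a grafting never yields a
forest without inner vertices. The coefficient is then nonzero exactly when `F₁` is the tree itself.

On the combinatorial side, a forest is determined by its trees with at least two leaves
(`bigTrees`), and being the union of `F₁` and `F₂` means that these trees are those of `F₁` and `F₂`
taken together (`isUnionOf_iff`). Existence and uniqueness of the union follow. -/

theorem IsBinaryTree.self_mem {A : Finset ι} {N : Finset (Finset ι)} (h : IsBinaryTree A N) :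
    A ∈ N := by
  cases h <;> simp

theorem IsBinaryTree.subset {A : Finset ι} {N : Finset (Finset ι)} (h : IsBinaryTree A N) :
    ∀ v ∈ N, v ⊆ A := by
  induction h with
  | leaf i => simp
  | graft h hA hB ih1 ih2 =>
    intro v hv
    rcases Finset.mem_insert.1 hv with rfl | hv
    · exact subset_rfl
    · rcases Finset.mem_union.1 hv with hv | hv
      · exact (ih1 v hv).trans Finset.subset_union_left
      · exact (ih2 v hv).trans Finset.subset_union_right

theorem LTree.card_leaves_pos (T : LTree ι) : 0 < T.leaves.card :=
  Finset.card_pos.2 T.leaves_nonempty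

/-- A tree with a single leaf has no inner vertex. -/
theorem LTree.eq_leaf (T : LTree ι) (h : T.leaves.card < 2) : ∃ i, T = LTree.leaf i := by
  obtain ⟨A, N, hT⟩ := T
  cases hT with
  | leaf i => exact ⟨i, rfl⟩
  | @graft A B N M hd hA hB =>
    have h1 := LTree.card_leaves_pos ⟨A, N, hA⟩
    have h2 := LTree.card_leaves_pos ⟨B, M, hB⟩
    simp only at h h1 h2
    rw [Finset.card_union_of_disjoint hd] at h
    omega

namespace Forest

variable {J K : Finset ι}

theorem eq_of_mem_leaves (F : Forest J) {T S : LTree ι} (hT : T ∈ F.trees) (hS : S ∈ F.trees)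
    {i : ι} (hi : i ∈ T.leaves) (hi' : i ∈ S.leaves) : T = S := by
  by_contra hne
  exact Finset.disjoint_left.1 (F.disjoint T hT S hS hne) hi hi'

theorem exists_mem_leaves (F : Forest J) {i : ι} (hi : i ∈ J) : ∃ T ∈ F.trees, i ∈ T.leaves := by
  rw [← F.cover] at hi
  simpa using hi

/-- The trees of a forest with at least one inner vertex. -/
def bigTrees (F : Forest J) : Finset (LTree ι) :=
  F.trees.filter fun T => 2 ≤ T.leaves.card

theorem mem_bigTrees {F : Forest J} {T : LTree ι} :
    T ∈ F.bigTrees ↔ T ∈ F.trees ∧ 2 ≤ T.leaves.card := Finset.mem_filter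

theorem support_eq_biUnion (F : Forest J) : F.support = F.bigTrees.biUnion LTree.leaves := by
  ext i
  simp only [support, Finset.mem_filter, Finset.mem_biUnion, mem_bigTrees]
  constructor
  · rintro ⟨_, T, hT, v, hv, hi, hc⟩
    have hs := T.isTree.subset v hv
    exact ⟨T, ⟨hT, hc.trans (Finset.card_le_card hs)⟩, hs hi⟩
  · rintro ⟨T, ⟨hT, hc⟩, hi⟩
    exact ⟨F.leaves_subset hT hi, T, hT, T.leaves, T.isTree.self_mem, hi, hc⟩

theorem on_support (F : Forest J) : F.on F.support = F.bigTrees := by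
  ext T
  simp only [on, Finset.mem_filter, mem_bigTrees, support_eq_biUnion]
  constructor
  · rintro ⟨hT, hs⟩
    obtain ⟨i, hi⟩ := T.leaves_nonempty
    obtain ⟨S, hS, hi'⟩ := Finset.mem_biUnion.1 (hs hi)
    rw [mem_bigTrees] at hS
    rw [F.eq_of_mem_leaves hT hS.1 hi hi']
    exact hS
  · rintro ⟨hT, hc⟩
    exact ⟨hT, Finset.subset_biUnion_of_mem LTree.leaves (mem_bigTrees.2 ⟨hT, hc⟩)⟩

/-- Two trees of `F` that share a leaf are equal. Once the big trees of `F₁` and `F₂` are trees of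
`F`, a big tree of `F` meets one of them by the condition on supports, hence is one of them. -/
theorem isUnionOf_iff {F F₁ F₂ : Forest J} :
    F.IsUnionOf F₁ F₂ ↔ F.bigTrees = F₁.bigTrees ∪ F₂.bigTrees := by
  have on_eq : ∀ G : Forest J, G.bigTrees ⊆ F.bigTrees → F.on G.support = G.bigTrees := by
    intro G hG
    ext T
    rw [on, Finset.mem_filter, support_eq_biUnion]
    constructor
    · rintro ⟨hT, hs⟩
      obtain ⟨i, hi⟩ := T.leaves_nonempty
      obtain ⟨S, hS, hi'⟩ := Finset.mem_biUnion.1 (hs hi)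
      rwa [F.eq_of_mem_leaves hT (mem_bigTrees.1 (hG hS)).1 hi hi']
    · intro hT
      exact ⟨(mem_bigTrees.1 (hG hT)).1, Finset.subset_biUnion_of_mem LTree.leaves hT⟩
  constructor
  · rintro ⟨h0, h1, h2⟩
    rw [on_support] at h1 h2
    have s1 : F₁.bigTrees ⊆ F.trees := by rw [← h1]; exact Finset.filter_subset _ _
    have s2 : F₂.bigTrees ⊆ F.trees := by rw [← h2]; exact Finset.filter_subset _ _
    ext T
    constructor
    · intro hT
      obtain ⟨i, hi⟩ := T.leaves_nonempty
      have hi' : i ∈ F.support := by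
        rw [support_eq_biUnion]; exact Finset.mem_biUnion.2 ⟨T, hT, hi⟩
      rw [h0, support_eq_biUnion, support_eq_biUnion, ← Finset.union_biUnion] at hi'
      obtain ⟨S, hS, hiS⟩ := Finset.mem_biUnion.1 hi'
      rwa [F.eq_of_mem_leaves (mem_bigTrees.1 hT).1 (Finset.union_subset s1 s2 hS) hi hiS]
    · intro hT
      refine mem_bigTrees.2 ⟨Finset.union_subset s1 s2 hT, ?_⟩
      rcases Finset.mem_union.1 hT with hT | hT <;> exact (mem_bigTrees.1 hT).2
  · intro h
    refine ⟨?_, ?_, ?_⟩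
    · rw [support_eq_biUnion, support_eq_biUnion, support_eq_biUnion, h, Finset.union_biUnion]
    · rw [on_support, on_eq]; rw [h]; exact Finset.subset_union_left
    · rw [on_support, on_eq]; rw [h]; exact Finset.subset_union_right

/-- A label outside the big trees can only be a tree by itself, so the big trees leave no freedom.
-/
theorem bigTrees_injective : Function.Injective (bigTrees (J := J)) := by
  have key : ∀ F G : Forest J, F.bigTrees = G.bigTrees → F.trees ⊆ G.trees := by
    intro F G h T hT
    by_cases hc : 2 ≤ T.leaves.card
    · have : T ∈ G.bigTrees := h ▸ mem_bigTrees.2 ⟨hT, hc⟩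
      exact (mem_bigTrees.1 this).1
    · obtain ⟨i, rfl⟩ := T.eq_leaf (not_le.1 hc)
      have hi : i ∈ J := F.leaves_subset hT (by simp [LTree.leaf])
      obtain ⟨S, hS, hiS⟩ := G.exists_mem_leaves hi
      by_cases hc' : 2 ≤ S.leaves.card
      · have : S ∈ F.bigTrees := h ▸ mem_bigTrees.2 ⟨hS, hc'⟩
        rwa [F.eq_of_mem_leaves hT (mem_bigTrees.1 this).1 (by simp [LTree.leaf]) hiS]
      · obtain ⟨j, rfl⟩ := S.eq_leaf (not_le.1 hc')
        have : i = j := by simpa [LTree.leaf] using hiS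
        rwa [this]
  intro F G h
  exact Forest.ext (subset_antisymm (key F G h) (key G F h.symm))

theorem exists_isUnionOf {F₁ F₂ : Forest J} (h : Disjoint F₁.support F₂.support) :
    ∃ F : Forest J, F.IsUnionOf F₁ F₂ := by
  set B := F₁.bigTrees ∪ F₂.bigTrees with hB
  set s := B.biUnion LTree.leaves with hs
  have hsub : ∀ G : Forest J, ∀ T ∈ G.bigTrees, T.leaves ⊆ G.support := by
    intro G T hT
    rw [support_eq_biUnion]
    exact Finset.subset_biUnion_of_mem LTree.leaves hT
  have hBJ : s ⊆ J := by
    rw [hs, Finset.biUnion_subset]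
    intro T hT
    rcases Finset.mem_union.1 hT with hT | hT
    · exact F₁.leaves_subset (mem_bigTrees.1 hT).1
    · exact F₂.leaves_subset (mem_bigTrees.1 hT).1
  have hBc : ∀ T ∈ B, 2 ≤ T.leaves.card := by
    intro T hT
    rcases Finset.mem_union.1 hT with hT | hT <;> exact (mem_bigTrees.1 hT).2
  have hBd : ∀ T ∈ B, ∀ S ∈ B, T ≠ S → Disjoint T.leaves S.leaves := by
    intro T hT S hS hne
    rcases Finset.mem_union.1 hT with hT | hT <;> rcases Finset.mem_union.1 hS with hS | hS
    · exact F₁.disjoint T (mem_bigTrees.1 hT).1 S (mem_bigTrees.1 hS).1 hne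
    · exact h.mono (hsub _ T hT) (hsub _ S hS)
    · exact h.symm.mono (hsub _ T hT) (hsub _ S hS)
    · exact F₂.disjoint T (mem_bigTrees.1 hT).1 S (mem_bigTrees.1 hS).1 hne
  have hBl : ∀ T ∈ B, ∀ i ∈ J \ s, Disjoint T.leaves (LTree.leaf i).leaves := by
    intro T hT i hi
    rw [LTree.leaf, Finset.disjoint_singleton_right]
    intro hiT
    exact (Finset.mem_sdiff.1 hi).2 (Finset.mem_biUnion.2 ⟨T, hT, hiT⟩)
  -- The labels not covered by the big trees are completed by trees with a single leaf.
  refine ⟨⟨B ∪ (J \ s).image LTree.leaf, ?_, ?_⟩, ?_⟩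
  · intro T hT S hS hne
    rcases Finset.mem_union.1 hT with hT | hT <;> rcases Finset.mem_union.1 hS with hS | hS
    · exact hBd T hT S hS hne
    · obtain ⟨i, hi, rfl⟩ := Finset.mem_image.1 hS
      exact hBl T hT i hi
    · obtain ⟨i, hi, rfl⟩ := Finset.mem_image.1 hT
      exact (hBl S hS i hi).symm
    · obtain ⟨i, hi, rfl⟩ := Finset.mem_image.1 hT
      obtain ⟨j, hj, rfl⟩ := Finset.mem_image.1 hS
      rw [LTree.leaf, LTree.leaf, Finset.disjoint_singleton]
      rintro rfl
      exact hne rfl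
  · rw [Finset.union_biUnion, ← hs, Finset.image_biUnion]
    simp only [LTree.leaf]
    rw [Finset.biUnion_singleton_eq_self, Finset.union_sdiff_of_subset hBJ]
  · rw [isUnionOf_iff, ← hB]
    ext T
    rw [mem_bigTrees]
    simp only [Finset.mem_union, Finset.mem_image]
    constructor
    · rintro ⟨hT | ⟨i, _, rfl⟩, hc⟩
      · exact hT
      · simp [LTree.leaf] at hc
    · exact fun hT => ⟨Or.inl hT, hBc T hT⟩

/-- The number of trees, counted by the leaves outside of the support and the big trees. -/
theorem card_trees_add (F : Forest J) :
    F.trees.card + F.support.card = J.card + F.bigTrees.card := by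
  have hd : ∀ s ⊆ F.trees, (s.biUnion LTree.leaves).card = ∑ T ∈ s, T.leaves.card :=
    fun s hs => Finset.card_biUnion fun T hT S hS hne => F.disjoint T (hs hT) S (hs hS) hne
  have h1 : F.support.card = ∑ T ∈ F.bigTrees, T.leaves.card := by
    rw [support_eq_biUnion, hd F.bigTrees (Finset.filter_subset _ _)]
  have h2 : J.card = ∑ T ∈ F.trees, T.leaves.card := by
    rw [← hd _ subset_rfl, F.cover]
  have h3 : ∑ T ∈ F.trees with ¬ 2 ≤ T.leaves.card, T.leaves.card =
      (F.trees.filter fun T => ¬ 2 ≤ T.leaves.card).card := by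
    rw [Finset.card_eq_sum_ones]
    refine Finset.sum_congr rfl fun T hT => ?_
    have := (Finset.mem_filter.1 hT).2
    have := T.card_leaves_pos
    omega
  have h4 := Finset.sum_filter_add_sum_filter_not F.trees (fun T => 2 ≤ T.leaves.card)
    fun T => T.leaves.card
  have h5 := Finset.card_filter_add_card_filter_not (s := F.trees) fun T => 2 ≤ T.leaves.card
  rw [bigTrees] at *
  omega

theorem two_mul_card_bigTrees_le (F : Forest J) : 2 * F.bigTrees.card ≤ F.support.card := by
  rw [support_eq_biUnion, Finset.card_biUnion fun T hT S hS hne =>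
    F.disjoint T (mem_bigTrees.1 hT).1 S (mem_bigTrees.1 hS).1 hne, mul_comm]
  exact Finset.card_nsmul_le_sum _ _ _ fun T hT => (mem_bigTrees.1 hT).2

theorem card_trees_le (F : Forest J) : F.trees.card ≤ J.card := by
  have h1 := F.card_trees_add
  have h2 := F.two_mul_card_bigTrees_le
  omega

theorem card_trees_of_bigTrees_eq_empty {F : Forest J} (h : F.bigTrees = ∅) :
    F.trees.card = J.card := by
  have := F.card_trees_add
  rw [support_eq_biUnion, h] at this
  simpa using this

/-! ### Disjoint unions of forests -/

theorem bigTrees_union (h : Disjoint J K) (F : Forest J) (G : Forest K) :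
    (F.union h G).bigTrees = F.bigTrees ∪ G.bigTrees :=
  Finset.filter_union _ _ _

theorem card_trees_union (h : Disjoint J K) (F : Forest J) (G : Forest K) :
    (F.union h G).trees.card = F.trees.card + G.trees.card :=
  Finset.card_union_of_disjoint (trees_disjoint h F G)

/-- Leaf sets are nonempty, so a tree of `G` never lies inside `J`. Both summands can thus be
recovered from their disjoint union. -/
theorem union_left_eq (h : Disjoint J K) (F : Forest J) (G : Forest K) :
    ((F.union h G).trees.filter fun T => T.leaves ⊆ J) = F.trees := by
  ext T
  simp only [union, Finset.mem_filter, Finset.mem_union]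
  constructor
  · rintro ⟨hT | hT, hs⟩
    · exact hT
    · obtain ⟨i, hi⟩ := T.leaves_nonempty
      exact absurd (G.leaves_subset hT hi) (Finset.disjoint_left.1 h (hs hi))
  · exact fun hT => ⟨Or.inl hT, F.leaves_subset hT⟩

theorem union_right_eq (h : Disjoint J K) (F : Forest J) (G : Forest K) :
    ((F.union h G).trees.filter fun T => T.leaves ⊆ K) = G.trees := by
  rw [← union_left_eq h.symm G F]
  simp only [union, Finset.union_comm]

theorem union_inj (h : Disjoint J K) {F F' : Forest J} {G G' : Forest K} :
    F.union h G = F'.union h G' ↔ F = F' ∧ G = G' := by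
  constructor
  · intro e
    constructor <;> apply Forest.ext
    · rw [← union_left_eq h F G, e, union_left_eq]
    · rw [← union_right_eq h F G, e, union_right_eq]
  · rintro ⟨rfl, rfl⟩
    rfl

/-- A tree with a single leaf always lies on one side, so only a big tree could straddle `J` and
`K`. -/
theorem exists_eq_union (h : Disjoint J K) (F : Forest (J ∪ K))
    (hF : ∀ T ∈ F.bigTrees, T.leaves ⊆ J ∨ T.leaves ⊆ K) :
    ∃ (G : Forest J) (H : Forest K), F = G.union h H := by
  have hF' : ∀ T ∈ F.trees, T.leaves ⊆ J ∨ T.leaves ⊆ K := by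
    intro T hT
    by_cases hc : 2 ≤ T.leaves.card
    · exact hF T (mem_bigTrees.2 ⟨hT, hc⟩)
    · obtain ⟨i, rfl⟩ := T.eq_leaf (not_le.1 hc)
      have := F.leaves_subset hT
      simpa [LTree.leaf] using this
  have cov : ∀ A B : Finset ι, Disjoint A B → A ⊆ J ∪ K →
      (∀ T ∈ F.trees, T.leaves ⊆ A ∨ T.leaves ⊆ B) →
      (F.trees.filter fun T => T.leaves ⊆ A).biUnion LTree.leaves = A := by
    intro A B hd hA hAB
    ext i
    simp only [Finset.mem_biUnion, Finset.mem_filter]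
    constructor
    · rintro ⟨T, ⟨_, hT⟩, hi⟩
      exact hT hi
    · intro hi
      obtain ⟨T, hT, hiT⟩ := F.exists_mem_leaves (hA hi)
      refine ⟨T, ⟨hT, (hAB T hT).resolve_right fun hB => ?_⟩, hiT⟩
      exact Finset.disjoint_left.1 hd hi (hB hiT)
  refine ⟨⟨F.trees.filter fun T => T.leaves ⊆ J, ?_, ?_⟩,
    ⟨F.trees.filter fun T => T.leaves ⊆ K, ?_, ?_⟩, ?_⟩
  · exact fun T hT S hS => F.disjoint T (Finset.mem_filter.1 hT).1 S (Finset.mem_filter.1 hS).1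
  · exact cov J K h Finset.subset_union_left hF'
  · exact fun T hT S hS => F.disjoint T (Finset.mem_filter.1 hT).1 S (Finset.mem_filter.1 hS).1
  · exact cov K J h.symm Finset.subset_union_right fun T hT => (hF' T hT).symm
  · ext T
    simp only [union, Finset.mem_union, Finset.mem_filter]
    constructor
    · exact fun hT => (hF' T hT).imp (⟨hT, ·⟩) (⟨hT, ·⟩)
    · rintro (⟨hT, _⟩ | ⟨hT, _⟩) <;> exact hT

end Forest

end Trees

/-! ### Coefficients of words in the exterior algebra -/

section Words

variable {ι : Type*} [DecidableEq ι]

theorem inv_word_eq (L : List (ι ⊕ LTree ι)) : inv (word L) = (-1 : ℚ) ^ L.length • word L := by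
  induction L with
  | nil => simp [word, inv]
  | cons g L ih =>
    have e : inv (word (g :: L)) = -gen g * inv (word L) := by
      rw [word_cons]
      simp [inv, gen]
    rw [e, ih, word_cons, List.length_cons, pow_succ]
    simp

theorem word_eq_zero_of_not_nodup {L : List (ι ⊕ LTree ι)} (h : ¬ L.Nodup) : word L = 0 := by
  obtain ⟨g, hg⟩ := List.exists_duplicate_iff_not_nodup.2 h
  obtain ⟨M, hM⟩ := (List.duplicate_iff_sublist.1 hg).exists_perm_append
  have e : word ([g, g] ++ M) = 0 := by
    simp only [List.cons_append, List.nil_append, word_cons, ← mul_assoc]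
    rw [gen, ExteriorAlgebra.ι_sq_zero, zero_mul]
  rcases word_perm hM with h | h <;> rw [h, e]
  simp

/-- A word with a repeated letter is zero, so `L'` may have repetitions. This spares a check on the
words produced by `bracket`. -/
theorem coeff_word_of_not_perm {L L' : List (ι ⊕ LTree ι)} (h : ¬ L.Perm L') :
    coeff L (word L') = 0 := by
  by_cases hn : L'.Nodup
  swap
  · rw [word_eq_zero_of_not_nodup hn, map_zero]
  induction L generalizing L' with
  | nil =>
    rcases L' with _ | ⟨g, L'⟩
    · exact absurd (List.Perm.refl _) h
    · simp [coeff, word_cons, gen, ExteriorAlgebra.algebraMapInv]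
  | cons g L ih =>
    rw [coeff, LinearMap.comp_apply]
    by_cases hg : g ∈ L'
    · obtain ⟨a, b, rfl⟩ := List.append_of_mem hg
      have p : (a ++ g :: b).Perm (g :: (a ++ b)) := List.perm_middle
      have z := ih (fun q => h ((q.cons g).trans p.symm))
        (List.nodup_cons.1 (p.nodup_iff.1 hn)).2
      rcases del_word_of_perm hn p with e | e <;> rw [e] <;> simp [z]
    · rw [del_word_of_notMem hg, map_zero]

theorem coeff_word_of_length_ne {L L' : List (ι ⊕ LTree ι)} (h : L.length ≠ L'.length) :
    coeff L (word L') = 0 :=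
  coeff_word_of_not_perm fun p => h p.length_eq

/-- The derivation `∂_g` sends a word to zero or, up to sign, to a word that is shorter by one. -/
theorem del_word_cases (g : ι ⊕ LTree ι) {L : List (ι ⊕ LTree ι)} (hL : L.Nodup) :
    del g (word L) = 0 ∨ ∃ M : List (ι ⊕ LTree ι), M.length + 1 = L.length ∧
      (del g (word L) = word M ∨ del g (word L) = -word M) := by
  by_cases hg : g ∈ L
  · right
    obtain ⟨a, b, rfl⟩ := List.append_of_mem hg
    have p : (a ++ g :: b).Perm (g :: (a ++ b)) := List.perm_middle
    exact ⟨a ++ b, p.length_eq.symm, del_word_of_perm hL p⟩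
  · exact Or.inl (del_word_of_notMem hg)

/-- Each term of the bracket removes one letter from each word and adds the root of the grafted
tree, so one letter is lost in total. -/
theorem coeff_bracket_word [Fintype ι] {L M N : List (ι ⊕ LTree ι)} (hM : M.Nodup) (hN : N.Nodup)
    (h : L.length + 1 ≠ M.length + N.length) : coeff L (bracket (word M) (word N)) = 0 := by
  simp only [bracket, LinearMap.sum_apply, map_sum]
  refine Finset.sum_eq_zero fun T _ => Finset.sum_eq_zero fun S _ => ?_
  split_ifs with hTS
  swap
  · simp
  simp only [LinearMap.compl₁₂_apply, LinearMap.comp_apply, LinearMap.mulLeft_apply, inv_word_eq, map_smul]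
  rcases del_word_cases (Sum.inr T) hM with e | ⟨A, hA, hA'⟩
  · simp [e]
  rcases del_word_cases (Sum.inr S) hN with e | ⟨B, hB, hB'⟩
  · simp [e]
  have key : coeff L (word (Sum.inr (T.graft S hTS) :: (A ++ B))) = 0 := by
    refine coeff_word_of_length_ne ?_
    simp only [List.length_cons, List.length_append]
    omega
  rw [word_cons, word_append, ← mul_assoc] at key
  rcases hA' with e | e <;> rcases hB' with e' | e' <;> simp [e, e', key]

end Words

/-! ### The basis of oriented forests, and the generators in this basis -/

section Bess

variable {ι : Type*} [DecidableEq ι] {J K : Finset ι}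

namespace Forest.Orientation

theorem length_list {F : Forest J} (o : F.Orientation) :
    o.list.length = J.card + F.trees.card := by
  have : o.list.toFinset = J.disjSum F.trees := by
    ext g
    rw [List.mem_toFinset, o.mem_iff]
  rw [← List.toFinset_card_of_nodup o.nodup, this, Finset.card_disjSum]

theorem elt_eq_or_neg {F : Forest J} (o p : F.Orientation) : o.elt = p.elt ∨ o.elt = -p.elt := by
  have : o.list.Perm p.list := (List.perm_ext_iff_of_nodup o.nodup p.nodup).2 fun g => by
    rw [o.mem_iff, p.mem_iff]
  exact (word_perm this).imp (fun h => Subtype.ext h) (fun h => Subtype.ext h)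

theorem dual_elt_ne_zero {F : Forest J} (o p : F.Orientation) : o.dual p.elt ≠ 0 := by
  have := o.dual_elt_self
  rcases o.elt_eq_or_neg p with h | h <;> intro h' <;> rw [h] at this <;> simp [h'] at this

theorem parity_elt {F : Forest J} (o : F.Orientation) :
    parity J o.elt = (-1 : ℚ) ^ (J.card + F.trees.card) • o.elt := by
  rw [← o.length_list]
  exact Subtype.ext (inv_word_eq o.list)

/-- The disjoint union of two oriented forests. -/
def union (h : Disjoint J K) {F : Forest J} {G : Forest K} (o : F.Orientation)
    (p : G.Orientation) : (F.union h G).Orientation where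
  list := o.list ++ p.list
  nodup := by
    refine o.nodup.append p.nodup ?_
    intro g hg hg'
    rw [o.mem_iff] at hg
    rw [p.mem_iff] at hg'
    rcases g with i | T
    · rw [Finset.inl_mem_disjSum] at hg hg'
      exact Finset.disjoint_left.1 h hg hg'
    · rw [Finset.inr_mem_disjSum] at hg hg'
      exact Finset.disjoint_left.1 (Forest.trees_disjoint h F G) hg hg'
  mem_iff := by
    intro g
    rw [List.mem_append, o.mem_iff, p.mem_iff]
    rcases g with i | T <;> simp [Forest.union]

end Forest.Orientation

theorem coe_opE_tmul (h : Disjoint J K) (x : Bess J) (y : Bess K) :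
    (opE h (x ⊗ₜ y) : Ext ι) = x * y := rfl

theorem opE_elt (h : Disjoint J K) {F : Forest J} {G : Forest K} (o : F.Orientation)
    (p : G.Orientation) : opE h (o.elt ⊗ₜ p.elt) = (o.union h p).elt :=
  Subtype.ext (word_append o.list p.list).symm

theorem span_elt (J : Finset ι) :
    Submodule.span ℚ {x : Bess J | ∃ (F : Forest J) (o : F.Orientation), o.elt = x} = ⊤ := by
  rw [eq_top_iff]
  rintro ⟨x, hx⟩ -
  induction hx using Submodule.span_induction with
  | mem x hx =>
    obtain ⟨F, o, rfl⟩ := hx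
    exact Submodule.subset_span ⟨F, o, rfl⟩
  | zero => exact zero_mem _
  | add x y hx hy hx' hy' => exact add_mem hx' hy'
  | smul a x hx hx' => exact Submodule.smul_mem _ a hx'

variable [Fintype ι]

omit [Fintype ι] in
/-- A linear map on `Bess(J)` is determined by its values on the forests, one orientation being
chosen for each. -/
theorem hom_ext {M : Type*} [AddCommGroup M] [Module ℚ M] {f g : Bess J →ₗ[ℚ] M}
    (h : ∀ F : Forest J, ∃ o : F.Orientation, f o.elt = g o.elt) : f = g := by
  refine LinearMap.ext_on (span_elt J) ?_
  rintro _ ⟨F, o, rfl⟩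
  obtain ⟨p, hp⟩ := h F
  rcases o.elt_eq_or_neg p with e | e <;> rw [e] <;> simp [hp]

/-- The expansion in the basis of the oriented forests. -/
theorem eq_sum_dual (x : Bess J) :
    x = ∑ F : Forest J, F.orientation.dual x • F.orientation.elt := by
  have : (LinearMap.id : Bess J →ₗ[ℚ] Bess J) =
      ∑ F : Forest J, F.orientation.dual.smulRight F.orientation.elt := by
    refine hom_ext fun F => ⟨F.orientation, ?_⟩
    rw [LinearMap.sum_apply, Finset.sum_eq_single F]
    · simp [Forest.Orientation.dual_elt_self]
    · intro G _ hG
      rw [LinearMap.smulRight_apply, Forest.Orientation.dual_elt_of_ne _ _ hG, zero_smul]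
    · simp
  conv_lhs => rw [← LinearMap.id_apply (R := ℚ) x, this]
  simp

theorem Forest.Orientation.dual_parity {F : Forest J} (o : F.Orientation) (x : Bess J) :
    o.dual (parity J x) = (-1 : ℚ) ^ (J.card + F.trees.card) * o.dual x := by
  have : o.dual ∘ₗ parity J = (-1 : ℚ) ^ (J.card + F.trees.card) • o.dual := by
    refine hom_ext fun G => ⟨G.orientation, ?_⟩
    rw [LinearMap.comp_apply, Forest.Orientation.parity_elt, map_smul, LinearMap.smul_apply]
    by_cases h : F = G
    · subst h; rfl
    · rw [Forest.Orientation.dual_elt_of_ne _ _ h, smul_zero, smul_zero]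
  simpa using LinearMap.congr_fun this x

/-- Both sides are bilinear and are compared on oriented forests. The scalar only compares `o` with
the concatenation of `p` and `q`, so it is a sign. -/
theorem dual_opE_union (h : Disjoint J K) {F : Forest J} {G : Forest K}
    (o : (F.union h G).Orientation) (p : F.Orientation) (q : G.Orientation) :
    ∃ c : ℚ, c ≠ 0 ∧ ∀ x y, o.dual (opE h (x ⊗ₜ y)) = c * (p.dual x * q.dual y) := by
  refine ⟨o.dual (p.union h q).elt, o.dual_elt_ne_zero _, ?_⟩
  have : TensorProduct.curry (o.dual ∘ₗ opE h) =
      o.dual (p.union h q).elt • (LinearMap.mul ℚ ℚ).compl₁₂ p.dual q.dual := by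
    refine hom_ext fun F' => ?_
    by_cases hF : F = F'
    · subst hF
      refine ⟨p, hom_ext fun G' => ?_⟩
      by_cases hG : G = G'
      · subst hG
        exact ⟨q, by simp [opE_elt, Forest.Orientation.dual_elt_self]⟩
      · refine ⟨G'.orientation, ?_⟩
        simp [opE_elt, Forest.Orientation.dual_elt_of_ne _ _ hG,
          o.dual_elt_of_ne (p.union h G'.orientation)
            (fun e => hG ((Forest.union_inj h).1 e).2)]
    · refine ⟨F'.orientation, hom_ext fun G' => ⟨G'.orientation, ?_⟩⟩
      simp [opE_elt, Forest.Orientation.dual_elt_of_ne _ _ hF,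
          o.dual_elt_of_ne (F'.orientation.union h G'.orientation)
            (fun e => hF ((Forest.union_inj h).1 e).1)]
  intro x y
  simpa using LinearMap.congr_fun₂ this x y

theorem dual_opE_of_ne (h : Disjoint J K) {F : Forest (J ∪ K)} (o : F.Orientation)
    (hF : ∀ (G : Forest J) (H : Forest K), F ≠ G.union h H) (z : Bess J ⊗[ℚ] Bess K) :
    o.dual (opE h z) = 0 := by
  have : TensorProduct.curry (o.dual ∘ₗ opE h) = 0 :=
    hom_ext fun G => ⟨G.orientation, hom_ext fun H => ⟨H.orientation, by
      simp [opE_elt, o.dual_elt_of_ne (G.orientation.union h H.orientation) (hF G H)]⟩⟩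
  have : o.dual ∘ₗ opE h = 0 := TensorProduct.curry_injective this
  exact LinearMap.congr_fun this z

-- Together with `dual_opΩ_elt` this is the grading by inner vertices, read on trees: a disjoint
-- union adds the numbers of trees, and a grafting loses one.
omit [Fintype ι] in
theorem dual_opE_elt (h : Disjoint J K) {F : Forest (J ∪ K)} {G : Forest J} {H : Forest K}
    (o : F.Orientation) (p : G.Orientation) (q : H.Orientation)
    (hc : o.dual (opE h (p.elt ⊗ₜ q.elt)) ≠ 0) :
    F.trees.card = G.trees.card + H.trees.card := by
  rw [opE_elt] at hc
  by_cases e : F = G.union h H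
  · rw [e, Forest.card_trees_union]
  · exact absurd (o.dual_elt_of_ne _ e) hc

theorem dual_opΩ_elt (h : Disjoint J K) {F : Forest (J ∪ K)} {G : Forest J} {H : Forest K}
    (o : F.Orientation) (p : G.Orientation) (q : H.Orientation)
    (hc : o.dual (opΩ h (p.elt ⊗ₜ q.elt)) ≠ 0) :
    F.trees.card + 1 = G.trees.card + H.trees.card := by
  by_contra hne
  refine hc (coeff_bracket_word p.nodup q.nodup ?_)
  rw [o.length_list, p.length_list, q.length_list, Finset.card_union_of_disjoint h]
  omega

/-- A forest without inner vertices is never the result of a grafting. -/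
theorem dual_opΩ_eq_zero (h : Disjoint J K) {F : Forest (J ∪ K)} (o : F.Orientation)
    (hF : F.bigTrees = ∅) (z : Bess J ⊗[ℚ] Bess K) : o.dual (opΩ h z) = 0 := by
  have : TensorProduct.curry (o.dual ∘ₗ opΩ h) = 0 := by
    refine hom_ext fun G => ⟨G.orientation, hom_ext fun H => ⟨H.orientation, ?_⟩⟩
    by_contra hc
    -- Without inner vertices, `F` has as many trees as labels, which is the maximum; a grafting has
    -- strictly fewer.
    have := dual_opΩ_elt h o G.orientation H.orientation hc
    have h1 := Forest.card_trees_of_bigTrees_eq_empty hF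
    have h2 := G.card_trees_le
    have h3 := H.card_trees_le
    rw [Finset.card_union_of_disjoint h] at h1
    omega
  have : o.dual ∘ₗ opΩ h = 0 := TensorProduct.curry_injective this
  exact LinearMap.congr_fun this z

-- The four terms encode the Koszul sign of moving `x'` past `y`, with no homogeneity assumption:
-- they amount to `1` if one of these is even and to `-1` if both are odd.
omit [Fintype ι] in
theorem tensorOp_tmul (P Q : Bess J ⊗[ℚ] Bess K →ₗ[ℚ] Bess (J ∪ K)) (x x' : Bess J)
    (y y' : Bess K) :
    tensorOp P Q ((x ⊗ₜ x') ⊗ₜ (y ⊗ₜ y')) = (1 / 2 : ℚ) •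
      (P (x ⊗ₜ y) ⊗ₜ Q (x' ⊗ₜ y') + P (x ⊗ₜ parity K y) ⊗ₜ Q (x' ⊗ₜ y')
        + P (x ⊗ₜ y) ⊗ₜ Q (parity J x' ⊗ₜ y') - P (x ⊗ₜ parity K y) ⊗ₜ Q (parity J x' ⊗ₜ y')) := by
  have e : -parity J = (-1 : ℚ) • parity J := LinearMap.ext fun x => Subtype.ext (by simp)
  simp only [tensorOp, braid, e, LinearMap.comp_apply, LinearEquiv.coe_coe,
    TensorProduct.tensorTensorTensorAssoc_tmul, TensorProduct.map_tmul, LinearMap.id_apply,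
    TensorProduct.comm_tmul, LinearMap.smul_apply, LinearMap.add_apply, TensorProduct.tmul_smul,
    ← TensorProduct.smul_tmul', TensorProduct.tmul_add, TensorProduct.add_tmul, map_smul, map_add,
    TensorProduct.tensorTensorTensorAssoc_symm_tmul]
  module

/-- The coefficient of the pair of the oriented forests `o`, `p` in an element of
`Bess(J) ⊗ Bess(J)`. -/
noncomputable def coeffPair {F G : Forest J} (o : F.Orientation) (p : G.Orientation) :
    Bess J ⊗[ℚ] Bess J →ₗ[ℚ] ℚ :=
  TensorProduct.dualDistrib ℚ (Bess J) (Bess J) (o.dual ⊗ₜ p.dual)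

omit [Fintype ι] in
theorem coeffPair_tmul {F G : Forest J} (o : F.Orientation) (p : G.Orientation) (x y : Bess J) :
    coeffPair o p (x ⊗ₜ y) = o.dual x * p.dual y := by
  simp [coeffPair]

/-- The expression equals the Koszul sign `(-1) ^ (m * n)`. -/
theorem sign_ne_zero (m n : ℕ) :
    (1 / 2 : ℚ) * (1 + (-1) ^ m + (-1) ^ n - (-1) ^ m * (-1) ^ n) ≠ 0 := by
  rcases neg_one_pow_eq_or ℚ m with h | h <;> rcases neg_one_pow_eq_or ℚ n with h' | h' <;>
    rw [h, h'] <;> norm_num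

/-- Pairing with `p'` and `q` fixes the parities of the two middle factors, so the Koszul sign is a
constant that does not depend on `a` and `b`. -/
theorem coeffPair_deltaE_union (h : Disjoint J K) {F F' : Forest J} {G G' : Forest K}
    (o : (F.union h G).Orientation) (o' : (F'.union h G').Orientation)
    (p : F.Orientation) (p' : F'.Orientation) (q : G.Orientation) (q' : G'.Orientation) :
    ∃ c : ℚ, c ≠ 0 ∧ ∀ a b,
      coeffPair o o' (deltaE h (a ⊗ₜ b)) = c * (coeffPair p p' a * coeffPair q q' b) := by
  obtain ⟨c, hc, e⟩ := dual_opE_union h o p q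
  obtain ⟨c', hc', e'⟩ := dual_opE_union h o' p' q'
  refine ⟨_, mul_ne_zero (mul_ne_zero hc hc')
    (sign_ne_zero (K.card + G.trees.card) (J.card + F'.trees.card)), fun a b => ?_⟩
  induction a with
  | zero => simp
  | add a₁ a₂ h₁ h₂ => rw [TensorProduct.add_tmul, map_add, map_add, h₁, h₂, map_add]; ring
  | tmul x x' =>
    induction b with
    | zero => simp
    | add a₁ a₂ h₁ h₂ => rw [TensorProduct.tmul_add, map_add, map_add, h₁, h₂, map_add]; ring
    | tmul y y' =>
      rw [deltaE, tensorOp_tmul]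
      simp only [map_smul, map_add, map_sub, coeffPair_tmul, e, e',
        Forest.Orientation.dual_parity, smul_eq_mul]
      ring

theorem coeffPair_deltaE_of_ne (h : Disjoint J K) {F F' : Forest (J ∪ K)}
    (o : F.Orientation) (o' : F'.Orientation)
    (hF : (∀ (G : Forest J) (H : Forest K), F ≠ G.union h H) ∨
      ∀ (G : Forest J) (H : Forest K), F' ≠ G.union h H) (a : Bess J ⊗[ℚ] Bess J)
    (b : Bess K ⊗[ℚ] Bess K) : coeffPair o o' (deltaE h (a ⊗ₜ b)) = 0 := by
  induction a with
  | zero => simp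
  | add a₁ a₂ h₁ h₂ => rw [TensorProduct.add_tmul, map_add, map_add, h₁, h₂, add_zero]
  | tmul x x' =>
    induction b with
    | zero => simp
    | add a₁ a₂ h₁ h₂ => rw [TensorProduct.tmul_add, map_add, map_add, h₁, h₂, add_zero]
    | tmul y y' =>
      rw [deltaE, tensorOp_tmul]
      rcases hF with hF | hF <;> simp [coeffPair_tmul, dual_opE_of_ne h _ hF]

end Bess

/-! ### The coproduct of a tree monomial: counting inner vertices -/

section Monomials

variable {ι : Type*} [DecidableEq ι] [Fintype ι] {J K : Finset ι}

theorem eq_sum_coeffPair (z : Bess J ⊗[ℚ] Bess J) :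
    z = ∑ F : Forest J, ∑ G : Forest J,
      coeffPair F.orientation G.orientation z • F.orientation.elt ⊗ₜ[ℚ] G.orientation.elt := by
  induction z with
  | zero => simp
  | add a b ha hb =>
    conv_lhs => rw [ha, hb]
    simp only [map_add, add_smul, Finset.sum_add_distrib]
  | tmul x y =>
    conv_lhs => rw [eq_sum_dual x, eq_sum_dual y]
    simp only [TensorProduct.sum_tmul, TensorProduct.tmul_sum, coeffPair_tmul,
      TensorProduct.tmul_smul, ← TensorProduct.smul_tmul', Finset.smul_sum, smul_smul]
    rw [Finset.sum_comm]
    simp only [mul_comm]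

/-- `Δ(Ω)` has degree one for the number of inner vertices. -/
theorem coeffPair_deltaΩ_elt (h : Disjoint J K) {F F' : Forest (J ∪ K)} {G G' : Forest J}
    {H H' : Forest K} (o : F.Orientation) (o' : F'.Orientation) (p : G.Orientation)
    (p' : G'.Orientation) (q : H.Orientation) (q' : H'.Orientation)
    (hc : coeffPair o o' (deltaΩ h ((p.elt ⊗ₜ p'.elt) ⊗ₜ (q.elt ⊗ₜ q'.elt))) ≠ 0) :
    F.trees.card + F'.trees.card + 1 =
      (G.trees.card + G'.trees.card) + (H.trees.card + H'.trees.card) := by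
  by_contra hne
  have h1 : o.dual (opE h (p.elt ⊗ₜ q.elt)) * o'.dual (opΩ h (p'.elt ⊗ₜ q'.elt)) = 0 := by
    by_contra hz
    have e1 := dual_opE_elt h o p q (left_ne_zero_of_mul hz)
    have e2 := dual_opΩ_elt h o' p' q' (right_ne_zero_of_mul hz)
    omega
  have h2 : o.dual (opΩ h (p.elt ⊗ₜ q.elt)) * o'.dual (opE h (p'.elt ⊗ₜ q'.elt)) = 0 := by
    by_contra hz
    have e1 := dual_opΩ_elt h o p q (left_ne_zero_of_mul hz)
    have e2 := dual_opE_elt h o' p' q' (right_ne_zero_of_mul hz)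
    omega
  refine hc ?_
  simp only [deltaΩ, LinearMap.add_apply, tensorOp_tmul, LinearMap.comp_apply,
    TensorProduct.map_tmul, Forest.Orientation.parity_elt, TensorProduct.tmul_smul,
    ← TensorProduct.smul_tmul', map_smul, map_add, map_sub, coeffPair_tmul, smul_eq_mul]
  simp only [h1, h2, mul_zero, add_zero, sub_zero]

/-- A forest on `J` has `|J|` minus its number of trees as number of inner vertices, so this says
that `F` and `G` share the `|J| - 1` inner vertices of a tree. -/
theorem TreeMonomial.card_add_card (t : TreeMonomial J) {F G : Forest J} (o : F.Orientation)
    (p : G.Orientation) (hc : coeffPair o p t.delta ≠ 0) :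
    F.trees.card + G.trees.card = J.card + 1 := by
  induction t with
  | leaf i =>
    have key : ∀ {F : Forest ({i} : Finset ι)} (o : F.Orientation), o.dual (unitElt i) ≠ 0 →
        F.trees.card = 1 := by
      intro F o ho
      by_cases e : F = (LTree.leaf i).toForest
      · simp [e, LTree.toForest]
      · exact absurd (o.dual_elt_of_ne _ e) ho
    rw [TreeMonomial.delta, coeffPair_tmul] at hc
    rw [key o (left_ne_zero_of_mul hc), key p (right_ne_zero_of_mul hc), Finset.card_singleton]
  | @node J K h s t ihs iht =>
    -- Expanding both tensors in the basis gives one nonzero term, to which the two induction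
    -- hypotheses and the degree of `Δ(Ω)` apply.
    rw [TreeMonomial.delta, eq_sum_coeffPair s.delta, eq_sum_coeffPair t.delta] at hc
    simp only [TensorProduct.sum_tmul, TensorProduct.tmul_sum, TensorProduct.tmul_smul,
      ← TensorProduct.smul_tmul', map_sum, map_smul, smul_eq_mul] at hc
    obtain ⟨H, -, hc⟩ := Finset.exists_ne_zero_of_sum_ne_zero hc
    obtain ⟨H', -, hc⟩ := Finset.exists_ne_zero_of_sum_ne_zero hc
    obtain ⟨G, -, hc'⟩ := Finset.exists_ne_zero_of_sum_ne_zero (right_ne_zero_of_mul hc)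
    obtain ⟨G', -, hc'⟩ := Finset.exists_ne_zero_of_sum_ne_zero hc'
    have e := coeffPair_deltaΩ_elt h _ _ _ _ _ _ (right_ne_zero_of_mul hc')
    have e₁ := ihs _ _ (left_ne_zero_of_mul hc')
    have e₂ := iht _ _ (left_ne_zero_of_mul hc)
    rw [Finset.card_union_of_disjoint h]
    omega

/-! ### The counit property up to a scalar -/

/-- The evaluation of the second factor at the dual of an oriented forest. -/
noncomputable def evalRight {F : Forest J} (o : F.Orientation) :
    Bess J ⊗[ℚ] Bess J →ₗ[ℚ] Bess J :=
  TensorProduct.rid ℚ (Bess J) ∘ₗ LinearMap.lTensor (Bess J) o.dual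

/-- The evaluation of the first factor at the dual of an oriented forest. -/
noncomputable def evalLeft {F : Forest J} (o : F.Orientation) :
    Bess J ⊗[ℚ] Bess J →ₗ[ℚ] Bess J :=
  TensorProduct.lid ℚ (Bess J) ∘ₗ LinearMap.rTensor (Bess J) o.dual

omit [Fintype ι] in
theorem evalRight_tmul {F : Forest J} (o : F.Orientation) (x y : Bess J) :
    evalRight o (x ⊗ₜ y) = o.dual y • x := by
  simp [evalRight]

omit [Fintype ι] in
theorem evalLeft_tmul {F : Forest J} (o : F.Orientation) (x y : Bess J) :
    evalLeft o (x ⊗ₜ y) = o.dual x • y := by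
  simp [evalLeft]

omit [Fintype ι] in
theorem dual_evalRight {F G : Forest J} (o : F.Orientation) (p : G.Orientation)
    (z : Bess J ⊗[ℚ] Bess J) : o.dual (evalRight p z) = coeffPair o p z := by
  induction z with
  | zero => simp
  | add a b ha hb => simp only [map_add, ha, hb]
  | tmul x y => rw [evalRight_tmul, coeffPair_tmul, map_smul, smul_eq_mul, mul_comm]

omit [Fintype ι] in
theorem dual_evalLeft {F G : Forest J} (o : F.Orientation) (p : G.Orientation)
    (z : Bess J ⊗[ℚ] Bess J) : p.dual (evalLeft o z) = coeffPair o p z := by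
  induction z with
  | zero => simp
  | add a b ha hb => simp only [map_add, ha, hb]
  | tmul x y => rw [evalLeft_tmul, coeffPair_tmul, map_smul, smul_eq_mul]

/-- An orientation of such a forest has `2 * |J|` letters, so it is even and creates no Koszul sign.
-/
theorem Forest.Orientation.dual_parity_of_bigTrees_eq_empty {F : Forest J} (o : F.Orientation)
    (hF : F.bigTrees = ∅) (x : Bess J) : o.dual (parity J x) = o.dual x := by
  rw [o.dual_parity, F.card_trees_of_bigTrees_eq_empty hF, ← two_mul, pow_mul]
  simp

/-- The summand `E ⊗ Ω` is killed by `dual_opΩ_eq_zero`. In `Ω ⊗ E` the second factors paired with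
`p` and `q` are even, so the braiding contributes no sign. -/
theorem evalRight_deltaΩ (h : Disjoint J K) {F : Forest J} {G : Forest K} (hF : F.bigTrees = ∅)
    (hG : G.bigTrees = ∅) (o : (F.union h G).Orientation) (p : F.Orientation)
    (q : G.Orientation) : ∃ c : ℚ, c ≠ 0 ∧ ∀ a b,
      evalRight o (deltaΩ h (a ⊗ₜ b)) = c • opΩ h (evalRight p a ⊗ₜ evalRight q b) := by
  obtain ⟨c, hc, e⟩ := dual_opE_union h o p q
  have hFG : (F.union h G).bigTrees = ∅ := by rw [Forest.bigTrees_union, hF, hG]; rfl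
  refine ⟨c, hc, fun a b => ?_⟩
  induction a with
  | zero => simp
  | add a₁ a₂ h₁ h₂ => simp only [TensorProduct.add_tmul, map_add, h₁, h₂, smul_add]
  | tmul x x' =>
    induction b with
    | zero => simp
    | add a₁ a₂ h₁ h₂ => simp only [TensorProduct.tmul_add, map_add, h₁, h₂, smul_add]
    | tmul y y' =>
      simp only [deltaΩ, LinearMap.add_apply, tensorOp_tmul, map_add, map_sub, map_smul,
        evalRight_tmul, dual_opΩ_eq_zero h o hFG, e, p.dual_parity_of_bigTrees_eq_empty hF,
        TensorProduct.tmul_smul, ← TensorProduct.smul_tmul', zero_smul]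
      module

/-- Here `Ω ⊗ E` is killed. The sign of `Ω` moving past the first factors is trivial too, since only
their even components are seen by `p` and `q`. -/
theorem evalLeft_deltaΩ (h : Disjoint J K) {F : Forest J} {G : Forest K} (hF : F.bigTrees = ∅)
    (hG : G.bigTrees = ∅) (o : (F.union h G).Orientation) (p : F.Orientation)
    (q : G.Orientation) : ∃ c : ℚ, c ≠ 0 ∧ ∀ a b,
      evalLeft o (deltaΩ h (a ⊗ₜ b)) = c • opΩ h (evalLeft p a ⊗ₜ evalLeft q b) := by
  obtain ⟨c, hc, e⟩ := dual_opE_union h o p q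
  have hFG : (F.union h G).bigTrees = ∅ := by rw [Forest.bigTrees_union, hF, hG]; rfl
  refine ⟨c, hc, fun a b => ?_⟩
  induction a with
  | zero => simp
  | add a₁ a₂ h₁ h₂ => simp only [TensorProduct.add_tmul, map_add, h₁, h₂, smul_add]
  | tmul x x' =>
    induction b with
    | zero => simp
    | add a₁ a₂ h₁ h₂ => simp only [TensorProduct.tmul_add, map_add, h₁, h₂, smul_add]
    | tmul y y' =>
      simp only [deltaΩ, LinearMap.add_apply, tensorOp_tmul, map_add, map_sub, map_smul,
        LinearMap.comp_apply, TensorProduct.map_tmul,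
        evalLeft_tmul, dual_opΩ_eq_zero h o hFG, e, p.dual_parity_of_bigTrees_eq_empty hF,
        q.dual_parity_of_bigTrees_eq_empty hG,
        TensorProduct.tmul_smul, ← TensorProduct.smul_tmul', zero_smul]
      module

omit [Fintype ι] in
theorem Forest.exists_eq_union_of_bigTrees_eq_empty (h : Disjoint J K) {F : Forest (J ∪ K)}
    (hF : F.bigTrees = ∅) : ∃ (G : Forest J) (H : Forest K), F = G.union h H ∧
      G.bigTrees = ∅ ∧ H.bigTrees = ∅ := by
  obtain ⟨G, H, rfl⟩ := F.exists_eq_union h (by simp [hF])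
  rw [Forest.bigTrees_union, Finset.union_eq_empty] at hF
  exact ⟨G, H, rfl, hF⟩

omit [Fintype ι] in
theorem dual_unitElt_ne_zero {i : ι} {F : Forest ({i} : Finset ι)} (hF : F.bigTrees = ∅)
    (o : F.Orientation) : o.dual (unitElt i) ≠ 0 := by
  have e : F = (LTree.leaf i).toForest := by
    refine Forest.bigTrees_injective (hF.trans ?_)
    simp [Forest.bigTrees, LTree.toForest, LTree.leaf, Finset.filter_singleton]
  subst e
  exact o.dual_elt_ne_zero _

theorem TreeMonomial.evalRight_delta (t : TreeMonomial J) {F : Forest J} (hF : F.bigTrees = ∅)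
    (o : F.Orientation) : ∃ c : ℚ, c ≠ 0 ∧ evalRight o t.delta = c • t.eval := by
  induction t with
  | leaf i => exact ⟨_, dual_unitElt_ne_zero hF o, evalRight_tmul o _ _⟩
  | node h s t ihs iht =>
    obtain ⟨G, H, rfl, hG, hH⟩ := Forest.exists_eq_union_of_bigTrees_eq_empty h hF
    obtain ⟨c, hc, e⟩ := evalRight_deltaΩ h hG hH o G.orientation H.orientation
    obtain ⟨c₁, hc₁, e₁⟩ := ihs hG G.orientation
    obtain ⟨c₂, hc₂, e₂⟩ := iht hH H.orientation
    refine ⟨c * (c₂ * c₁), mul_ne_zero hc (mul_ne_zero hc₂ hc₁), ?_⟩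
    rw [TreeMonomial.delta, e, e₁, e₂, TreeMonomial.eval, TensorProduct.tmul_smul,
      ← TensorProduct.smul_tmul', map_smul, map_smul, smul_smul, smul_smul,
      mul_assoc]

theorem TreeMonomial.evalLeft_delta (t : TreeMonomial J) {F : Forest J} (hF : F.bigTrees = ∅)
    (o : F.Orientation) : ∃ c : ℚ, c ≠ 0 ∧ evalLeft o t.delta = c • t.eval := by
  induction t with
  | leaf i => exact ⟨_, dual_unitElt_ne_zero hF o, evalLeft_tmul o _ _⟩
  | node h s t ihs iht =>
    obtain ⟨G, H, rfl, hG, hH⟩ := Forest.exists_eq_union_of_bigTrees_eq_empty h hF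
    obtain ⟨c, hc, e⟩ := evalLeft_deltaΩ h hG hH o G.orientation H.orientation
    obtain ⟨c₁, hc₁, e₁⟩ := ihs hG G.orientation
    obtain ⟨c₂, hc₂, e₂⟩ := iht hH H.orientation
    refine ⟨c * (c₂ * c₁), mul_ne_zero hc (mul_ne_zero hc₂ hc₁), ?_⟩
    rw [TreeMonomial.delta, e, e₁, e₂, TreeMonomial.eval, TensorProduct.tmul_smul,
      ← TensorProduct.smul_tmul', map_smul, map_smul, smul_smul, smul_smul,
      mul_assoc]

/-- A converse to `exists_treeMonomial_aux`: the monomial is given and the tree is found. Writing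
the root first makes `bracket_word` directly applicable in the induction. -/
theorem TreeMonomial.eval_eq_word (t : TreeMonomial J) :
    ∃ (T : LTree ι) (L : List ι), T.leaves = J ∧ L.Nodup ∧ (∀ i, i ∈ L ↔ i ∈ J) ∧
      ((t.eval : Ext ι) = word (Sum.inr T :: L.map Sum.inl) ∨
        (t.eval : Ext ι) = -word (Sum.inr T :: L.map Sum.inl)) := by
  induction t with
  | leaf i =>
    refine ⟨LTree.leaf i, [i], rfl, by simp, by simp, ?_⟩
    rw [TreeMonomial.eval, coe_unitElt]
    exact word_perm (List.Perm.swap _ _ _)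
  | node h s t ihs iht =>
    obtain ⟨T, L, rfl, hL, hL', hs⟩ := ihs
    obtain ⟨S, M, rfl, hM, hM', ht⟩ := iht
    refine ⟨T.graft S h, L ++ M, rfl, hL.append hM ?_, ?_, ?_⟩
    · intro i hi hi'
      exact Finset.disjoint_left.1 h ((hL' i).1 hi) ((hM' i).1 hi')
    · intro i
      rw [List.mem_append, hL', hM', Finset.mem_union]
    · have e : ((TreeMonomial.node h s t).eval : Ext ι) = bracket (s.eval : Ext ι) t.eval := rfl
      rw [e]
      rcases hs with hs | hs <;> rcases ht with ht | ht <;>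
        rcases bracket_word T S h L M with h' | h' <;> simp [hs, ht, h']

/-- The value of a monomial in `Ω` is, up to sign, a forest with a single tree. -/
theorem TreeMonomial.exists_eval_eq (t : TreeMonomial J) :
    ∃ (F : Forest J) (o : F.Orientation), F.trees.card = 1 ∧ (t.eval = o.elt ∨ t.eval = -o.elt) := by
  obtain ⟨T, L, rfl, hL, hL', ht⟩ := t.eval_eq_word
  refine ⟨T.toForest, ⟨Sum.inr T :: L.map Sum.inl, ?_, ?_⟩, rfl, ?_⟩
  · exact List.nodup_cons.2 ⟨by simp, hL.map Sum.inl_injective⟩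
  · rintro (i | U) <;> simp [hL', LTree.toForest]
  · exact ht.imp (fun e => Subtype.ext e) (fun e => Subtype.ext e)

omit [Fintype ι] in
theorem Forest.Orientation.dual_ne_zero_iff {F G : Forest J} (o : F.Orientation)
    (p : G.Orientation) {x : Bess J} (hx : x = p.elt ∨ x = -p.elt) : o.dual x ≠ 0 ↔ F = G := by
  have : o.dual x ≠ 0 ↔ o.dual p.elt ≠ 0 := by rcases hx with rfl | rfl <;> simp
  rw [this]
  constructor
  · exact fun h => by_contra fun e => h (o.dual_elt_of_ne p e)
  · rintro rfl
    exact o.dual_elt_ne_zero p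

theorem TreeMonomial.coeffPair_delta_ne_zero_iff (t : TreeMonomial J) {F F₁ F₂ : Forest J}
    (o : F.Orientation) (hF : F.trees.card = 1) (ht : t.eval = o.elt ∨ t.eval = -o.elt)
    (o₁ : F₁.Orientation) (o₂ : F₂.Orientation) (h : Disjoint F₁.support F₂.support) :
    coeffPair o₁ o₂ t.delta ≠ 0 ↔ F.IsUnionOf F₁ F₂ := by
  rw [Forest.isUnionOf_iff]
  have right : F₂.bigTrees = ∅ →
      (coeffPair o₁ o₂ t.delta ≠ 0 ↔ F.bigTrees = F₁.bigTrees ∪ F₂.bigTrees) := by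
    intro h₂
    obtain ⟨c, hc, e⟩ := t.evalRight_delta h₂ o₂
    rw [← dual_evalRight, e, map_smul, smul_ne_zero_iff_right hc, o₁.dual_ne_zero_iff o ht, h₂,
      Finset.union_empty, Forest.bigTrees_injective.eq_iff, eq_comm]
  have left : F₁.bigTrees = ∅ →
      (coeffPair o₁ o₂ t.delta ≠ 0 ↔ F.bigTrees = F₁.bigTrees ∪ F₂.bigTrees) := by
    intro h₁
    obtain ⟨c, hc, e⟩ := t.evalLeft_delta h₁ o₁
    rw [← dual_evalLeft, e, map_smul, smul_ne_zero_iff_right hc, o₂.dual_ne_zero_iff o ht, h₁,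
      Finset.empty_union, Forest.bigTrees_injective.eq_iff, eq_comm]
  by_cases h₁ : F₁.bigTrees = ∅
  · exact left h₁
  by_cases h₂ : F₂.bigTrees = ∅
  · exact right h₂
  refine iff_of_false (fun hc => ?_) fun e => ?_
  -- With `bₐ` big trees and support of size `sₐ`, the counts give `s₁ + s₂ + 1 = |J| + b₁ + b₂`. As
  -- `s₁ + s₂ ≤ |J|`, this forces `b₁ + b₂ ≤ 1`, although both are positive.
  · have c := t.card_add_card o₁ o₂ hc
    have hs : F₁.support.card + F₂.support.card ≤ J.card := by
      rw [← Finset.card_union_of_disjoint h]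
      exact Finset.card_le_card
        (Finset.union_subset (Finset.filter_subset _ _) (Finset.filter_subset _ _))
    have := F₁.card_trees_add
    have := F₂.card_trees_add
    have := F₁.two_mul_card_bigTrees_le
    have := F₂.two_mul_card_bigTrees_le
    have := Finset.card_pos.2 (Finset.nonempty_iff_ne_empty.2 h₁)
    have := Finset.card_pos.2 (Finset.nonempty_iff_ne_empty.2 h₂)
    omega
  -- The only tree of `F` would be a big tree of both `F₁` and `F₂`, so its leaves would lie in both
  -- supports.
  · obtain ⟨T, hT⟩ := Finset.nonempty_iff_ne_empty.2 h₁
    obtain ⟨S, hS⟩ := Finset.nonempty_iff_ne_empty.2 h₂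
    obtain ⟨U, hU⟩ := Finset.card_eq_one.1 hF
    have key : ∀ V ∈ F₁.bigTrees ∪ F₂.bigTrees, V = U := by
      intro V hV
      rw [← e, Forest.mem_bigTrees, hU] at hV
      exact Finset.mem_singleton.1 hV.1
    rw [key T (Finset.mem_union_left _ hT)] at hT
    rw [key S (Finset.mem_union_right _ hS)] at hS
    obtain ⟨i, hi⟩ := U.leaves_nonempty
    rw [Forest.support_eq_biUnion, Forest.support_eq_biUnion] at h
    exact Finset.disjoint_left.1 h (Finset.mem_biUnion.2 ⟨U, hT, hi⟩)
      (Finset.mem_biUnion.2 ⟨U, hS, hi⟩)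

/-! ### From trees to forests -/

omit [Fintype ι] in
theorem Forest.isUnionOf_union (h : Disjoint J K) {F F₁ F₂ : Forest J} {G G₁ G₂ : Forest K} :
    (F.union h G).IsUnionOf (F₁.union h G₁) (F₂.union h G₂) ↔
      F.IsUnionOf F₁ F₂ ∧ G.IsUnionOf G₁ G₂ := by
  simp only [Forest.isUnionOf_iff, Forest.bigTrees_union]
  constructor
  · intro e
    -- Sorting the big trees by whether their leaves lie in `J` or in `K` separates the equality
    -- into its two halves.
    have sub : ∀ (H : Forest J) (H' : Forest K),
        ((H.bigTrees ∪ H'.bigTrees).filter fun T => T.leaves ⊆ J) = H.bigTrees ∧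
        ((H.bigTrees ∪ H'.bigTrees).filter fun T => T.leaves ⊆ K) = H'.bigTrees := by
      intro H H'
      have e₁ := Forest.union_left_eq h H H'
      have e₂ := Forest.union_right_eq h H H'
      rw [← Forest.bigTrees_union, Forest.bigTrees, Finset.filter_comm, e₁, Finset.filter_comm, e₂]
      · exact ⟨rfl, rfl⟩
      · exact h
    rw [Finset.union_union_union_comm] at e
    constructor
    · have := congrArg (Finset.filter fun T => T.leaves ⊆ J) e
      rw [Finset.union_union_union_comm] at this
      rw [(sub _ _).1, Finset.filter_union, (sub _ _).1, (sub _ _).1] at this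
      exact this
    · have := congrArg (Finset.filter fun T => T.leaves ⊆ K) e
      rw [Finset.union_union_union_comm] at this
      rw [(sub _ _).2, Finset.filter_union, (sub _ _).2, (sub _ _).2] at this
      exact this
  · rintro ⟨e₁, e₂⟩
    rw [e₁, e₂, Finset.union_union_union_comm]

omit [Fintype ι] in
theorem Forest.support_union (h : Disjoint J K) (F : Forest J) (G : Forest K) :
    (F.union h G).support = F.support ∪ G.support := by
  rw [Forest.support_eq_biUnion, Forest.bigTrees_union, Finset.union_biUnion,
    ← Forest.support_eq_biUnion, ← Forest.support_eq_biUnion]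

omit [Fintype ι] in
/-- If a disjoint union of forests is the union of `F₁` and `F₂`, then these are disjoint unions
as well. -/
theorem Forest.IsUnionOf.exists_eq_union (h : Disjoint J K) {F : Forest J} {G : Forest K}
    {F₁ F₂ : Forest (J ∪ K)} (hu : (F.union h G).IsUnionOf F₁ F₂) :
    (∃ (F' : Forest J) (G' : Forest K), F₁ = F'.union h G') ∧
      ∃ (F' : Forest J) (G' : Forest K), F₂ = F'.union h G' := by
  rw [Forest.isUnionOf_iff, Forest.bigTrees_union] at hu
  have key : ∀ T ∈ F₁.bigTrees ∪ F₂.bigTrees, T.leaves ⊆ J ∨ T.leaves ⊆ K := by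
    intro T hT
    rw [← hu] at hT
    exact (Finset.mem_union.1 hT).imp (fun hT => F.leaves_subset (Forest.mem_bigTrees.1 hT).1)
      (fun hT => G.leaves_subset (Forest.mem_bigTrees.1 hT).1)
  exact ⟨Forest.exists_eq_union h F₁ fun T hT => key T (Finset.mem_union_left _ hT),
    Forest.exists_eq_union h F₂ fun T hT => key T (Finset.mem_union_right _ hT)⟩

/-- The monomial chosen for a forest is known only through its value. The criterion is therefore
proved for every monomial, jointly with the forest that it represents. -/
theorem ForestMonomial.exists_eval_eq (t : ForestMonomial J) :
    ∃ (F : Forest J) (o : F.Orientation), (t.eval = o.elt ∨ t.eval = -o.elt) ∧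
      ∀ (F₁ F₂ : Forest J) (o₁ : F₁.Orientation) (o₂ : F₂.Orientation),
        Disjoint F₁.support F₂.support →
          (coeffPair o₁ o₂ t.delta ≠ 0 ↔ F.IsUnionOf F₁ F₂) := by
  induction t with
  | nil =>
    -- There is only the empty forest on `∅`, so both sides of the equivalence hold.
    have uniq : ∀ F G : Forest (∅ : Finset ι), F = G := by
      have key : ∀ F : Forest (∅ : Finset ι), F.trees = ∅ := by
        intro F
        have := F.card_trees_le
        rwa [Finset.card_empty, Nat.le_zero, Finset.card_eq_zero] at this
      exact fun F G => Forest.ext ((key F).trans (key G).symm)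
    refine ⟨⟨∅, by simp, by simp⟩, ⟨[], by simp, by simp⟩, Or.inl rfl, fun F₁ F₂ o₁ o₂ _ => ?_⟩
    refine iff_of_true ?_ ?_
    · rw [ForestMonomial.delta, coeffPair_tmul]
      exact mul_ne_zero ((o₁.dual_ne_zero_iff _ (Or.inl rfl)).2 (uniq _ _))
        ((o₂.dual_ne_zero_iff _ (Or.inl rfl)).2 (uniq _ _))
    · rw [Forest.isUnionOf_iff, uniq F₁ F₂, Finset.union_self, uniq F₂]
  | cons h s t ih =>
    obtain ⟨G, q, hq, hG⟩ := ih
    obtain ⟨F, p, hF, hp⟩ := s.exists_eval_eq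
    refine ⟨F.union h G, p.union h q, ?_, fun F₁ F₂ o₁ o₂ hd => ?_⟩
    · rw [ForestMonomial.eval, ← opE_elt]
      rcases hp with e | e <;> rcases hq with e' | e' <;>
        simp [Subtype.ext_iff, coe_opE_tmul, e, e']
    rw [ForestMonomial.delta]
    -- If `F₁` or `F₂` does not split along the two sets of labels, both sides fail: the coefficient
    -- vanishes, and a union that splits forces both of them to split.
    by_cases h₁ : ∃ (F' : Forest _) (G' : Forest _), F₁ = F'.union h G'
    swap
    · push Not at h₁
      refine iff_of_false (fun hc => hc (coeffPair_deltaE_of_ne h o₁ o₂ (Or.inl h₁) _ _)) ?_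
      intro hu
      obtain ⟨⟨F', G', e⟩, -⟩ := hu.exists_eq_union
      exact h₁ F' G' e
    by_cases h₂ : ∃ (F' : Forest _) (G' : Forest _), F₂ = F'.union h G'
    swap
    · push Not at h₂
      refine iff_of_false (fun hc => hc (coeffPair_deltaE_of_ne h o₁ o₂ (Or.inr h₂) _ _)) ?_
      intro hu
      obtain ⟨-, ⟨F', G', e⟩⟩ := hu.exists_eq_union
      exact h₂ F' G' e
    obtain ⟨F₁, G₁, rfl⟩ := h₁
    obtain ⟨F₂, G₂, rfl⟩ := h₂
    rw [Forest.support_union, Forest.support_union, Finset.disjoint_union_left,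
      Finset.disjoint_union_right, Finset.disjoint_union_right] at hd
    obtain ⟨c, hc, e⟩ := coeffPair_deltaE_union h o₁ o₂ F₁.orientation F₂.orientation
      G₁.orientation G₂.orientation
    rw [e, Forest.isUnionOf_union, mul_ne_zero_iff_left hc, mul_ne_zero_iff,
      s.coeffPair_delta_ne_zero_iff p hF hp _ _ hd.1.1, hG _ _ _ _ hd.2.2]

theorem Forest.coeffPair_delta_monomial_ne_zero_iff (F : Forest J) {F₁ F₂ : Forest J}
    (o₁ : F₁.Orientation) (o₂ : F₂.Orientation) (h : Disjoint F₁.support F₂.support) :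
    coeffPair o₁ o₂ F.monomial.delta ≠ 0 ↔ F.IsUnionOf F₁ F₂ := by
  obtain ⟨G, p, hp, hG⟩ := F.monomial.exists_eval_eq
  -- The value of the monomial is `F` with an orientation and also, up to sign, `G` with an
  -- orientation; distinct forests are independent.
  have : F = G := by
    rw [F.eval_monomial] at hp
    exact (F.orientation.dual_ne_zero_iff p hp).1 (F.orientation.dual_elt_ne_zero _)
  subst this
  exact hG _ _ o₁ o₂ h

/-- Only the summand of `coproduct` indexed by `F` is nonzero on `F`, and the choice of an
orientation of `F` only changes a sign. -/
theorem Forest.appears_dualMul_iff (F : Forest J) {F₁ F₂ : Forest J}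
    (o₁ : F₁.Orientation) (o₂ : F₂.Orientation) :
    F.Appears (dualMul o₁.dual o₂.dual) ↔ coeffPair o₁ o₂ F.monomial.delta ≠ 0 := by
  have key : ∀ o : F.Orientation, dualMul o₁.dual o₂.dual o.elt =
      F.orientation.dual o.elt * coeffPair o₁ o₂ F.monomial.delta := by
    intro o
    rw [dualMul, LinearMap.comp_apply, coproduct, LinearMap.sum_apply, Finset.sum_eq_single F]
    · rw [LinearMap.smulRight_apply, map_smul, smul_eq_mul]
      rfl
    · intro G _ hG
      rw [LinearMap.smulRight_apply, Forest.Orientation.dual_elt_of_ne _ _ hG, zero_smul]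
    · simp
  constructor
  · rintro ⟨o, ho⟩
    rw [key] at ho
    exact right_ne_zero_of_mul ho
  · intro hc
    refine ⟨F.orientation, ?_⟩
    rw [key]
    exact mul_ne_zero (F.orientation.dual_elt_ne_zero _) hc

end Monomials

end Bessel

/-! ### The proposition -/

theorem mainTheorem8 {ι : Type*} [Fintype ι] [DecidableEq ι] (I : Finset ι)
    (F₁ F₂ : Bessel.Forest I) (o₁ : F₁.Orientation) (o₂ : F₂.Orientation)
    (h : Disjoint F₁.support F₂.support) :
    (∃! F : Bessel.Forest I, F.IsUnionOf F₁ F₂) ∧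
      ∀ F : Bessel.Forest I,
        F.Appears (Bessel.dualMul o₁.dual o₂.dual) ↔ F.IsUnionOf F₁ F₂ := by
  refine ⟨?_, fun F => ?_⟩
  · obtain ⟨F, hF⟩ := Bessel.Forest.exists_isUnionOf h
    refine ⟨F, hF, fun G hG => Bessel.Forest.bigTrees_injective ?_⟩
    rw [Bessel.Forest.isUnionOf_iff.1 hF, Bessel.Forest.isUnionOf_iff.1 hG]
  · rw [F.appears_dualMul_iff, F.coeffPair_delta_monomial_ne_zero_iff o₁ o₂ h]
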